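/- All graphs are finite, simple and undirected. Let $X$ be a graph, let $m\ge 1$ and $n\ge 2$ be integers, and compose automorphisms from left to right, so that $\sigma\rho$ means first $\sigma$, then $\rho$. The graph $X$ is a weak $(m,n)$-metacirculant relative to $(\rho,\sigma)$, where $\rho,\sigma\in\mathrm{Aut}\,X$, if $\rho$ has exactly $m$ orbits on $V(X)$, all of length $n$, if $\sigma^{-1}\rho\sigma=\rho^r$ for some $r\in\mathbb{Z}_n^*$, and if $\sigma$ permutes the $m$ orbits of $\rho$ cyclically (in a single $m$-cycle). If moreover $\sigma^m$ fixes a vertex, then $X$ is an $(m,n)$-metacirculant (relative to $(\rho,\sigma)$). A quartic weak $(m,n)$-metacirculant is of Class II relative to $(\rho,\sigma)$ if every vertex has exactly two neighbours in its own $\rho$-orbit, and each $\rho$-orbit $O$ is joined by edges to exactly two other $\rho$-orbits, every vertex of $O$ having exactly one neighbour in each of these two. The graph $X$ is half-arc-transitive if $\mathrm{Aut}\,X$ is transitive on the vertices and on the edges, but not on the arcs, of $X$. For such a quartic $X$, orient the edges by one of the two orbits of $\mathrm{Aut}\,X$ on the arcs. An alternating cycle is a cycle of even length in $X$ whose vertices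 are alternately the tail and the head of both of their incident edges on the cycle; two distinct alternating cycles are adjacent if they have a common vertex. The graph $X$ is tightly attached if the number of common vertices of any two adjacent alternating cycles is half the length of an alternating cycle. Proposition. Let $X$ be a connected quartic half-arc-transitive graph which is a weak $(m,n)$-metacirculant of Class II relative to a pair $(\rho,\sigma)$ of automorphisms, and suppose that $X$ is not tightly attached. Then $X$ is an $(m,n)$-metacirculant. Concretely, there is an integer $k\ge 0$ such that $\sigma\rho^k$ has order $m$, and $X$ is an $(m,n)$-metacirculant relative to $(\rho,\sigma\rho^k)$. -/

import Mathlib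

namespace HalfArc

variable {V : Type*}

/-- The automorphism group of `X` is transitive on the vertices. -/
def VertexTransitive (X : SimpleGraph V) : Prop :=
  ∀ u v : V, ∃ g : X ≃g X, g u = v

/-- The automorphism group of `X` is transitive on the edges. -/
def EdgeTransitive (X : SimpleGraph V) : Prop :=
  ∀ e ∈ X.edgeSet, ∀ f ∈ X.edgeSet, ∃ g : X ≃g X, Sym2.map g e = f

/-- The automorphism group of `X` is transitive on the arcs (ordered pairs of adjacent
vertices). -/
def ArcTransitive (X : SimpleGraph V) : Prop :=
  ∀ u v x y : V, X.Adj u v → X.Adj x y → ∃ g : X ≃g X, g u = x ∧ g v = y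

/-- Vertex- and edge- but not arc-transitive. -/
def IsHalfArcTransitive (X : SimpleGraph V) : Prop :=
  VertexTransitive X ∧ EdgeTransitive X ∧ ¬ ArcTransitive X

/-! ### Alternating cycles and tight attachment -/

/-- The orbital of the automorphism group of `X` that contains the pair `(a, b)`, as a relation
on the vertices. If `X` is half-arc-transitive and `(a, b)` is an arc, then this is one of the two
(mutually opposite) orientations of `X` induced by the automorphism group. -/
def arcOrbital (X : SimpleGraph V) (a b : V) : V → V → Prop :=
  fun x y => ∃ g : X ≃g X, g a = x ∧ g b = y

/-- `p` is a cycle of even length in `X` whose vertices are alternately the tail and the head, in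
the orientation `D`, of both of their incident edges on the cycle; its initial vertex is a tail. -/
def IsAlternatingCycle {X : SimpleGraph V} (D : V → V → Prop) {v : V} (p : X.Walk v v) : Prop :=
  p.IsCycle ∧ Even p.length ∧
    ∀ i < p.length,
      (Even i → D (p.getVert i) (p.getVert (i + 1))) ∧
      (Odd i → D (p.getVert (i + 1)) (p.getVert i))

/-- Two closed walks give rise to adjacent cycles: the cycles are different, and they have a common
vertex. -/
def AdjacentCycles {X : SimpleGraph V} {v w : V} (p : X.Walk v v) (q : X.Walk w w) : Prop :=
  {e | e ∈ p.edges} ≠ {e | e ∈ q.edges} ∧ ∃ x, x ∈ p.support ∧ x ∈ q.support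

/-- For a quartic half-arc-transitive graph `X`: any two adjacent alternating cycles have half of
their vertices in common, that is, the attachment number (the number of vertices in the intersection
of two adjacent alternating cycles) is equal to the radius (half of the length of an alternating
cycle). -/
def IsTightlyAttached (X : SimpleGraph V) : Prop :=
  ∀ a b : V, X.Adj a b → ∀ (v w : V) (p : X.Walk v v) (q : X.Walk w w),
    IsAlternatingCycle (arcOrbital X a b) p → IsAlternatingCycle (arcOrbital X a b) q →
      AdjacentCycles p q → 2 * {x | x ∈ p.support ∧ x ∈ q.support}.ncard = p.length

/-! ### Metacirculants -/

/-- The set of the orbits of (the cyclic group generated by) the automorphism `ρ`. -/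
def orbits {X : SimpleGraph V} (ρ : X ≃g X) : Set (Set V) :=
  Set.range fun v : V => MulAction.orbit (Subgroup.zpowers ρ) v

/-- `ρ` has `m` orbits of length `n` and no other orbit. -/
def IsSemiregular {X : SimpleGraph V} (m n : ℕ) (ρ : X ≃g X) : Prop :=
  (orbits ρ).ncard = m ∧ ∀ O ∈ orbits ρ, O.ncard = n

/-- `σ` permutes the members of `S`, in a single cycle. -/
def CyclicallyPermutes {X : SimpleGraph V} (σ : X ≃g X) (S : Set (Set V)) : Prop :=
  (∀ O ∈ S, σ '' O ∈ S) ∧ ∀ O ∈ S, ∀ P ∈ S, ∃ k : ℕ, ⇑(σ ^ k) '' O = P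

/-- `X` is a weak `(m, n)`-metacirculant relative to the ordered pair `(ρ, σ)`.
Automorphisms act on the right in the source of this notion, so that its `σ⁻¹ρσ` (apply `σ⁻¹`
first, then `ρ`, then `σ`) is the product `σ * ρ * σ⁻¹` in the group `X ≃g X`. -/
def IsWeakMetacirculantRel (X : SimpleGraph V) (m n : ℕ) (ρ σ : X ≃g X) : Prop :=
  1 ≤ m ∧ 2 ≤ n ∧ IsSemiregular m n ρ ∧
    (∃ r : ℕ, r.Coprime n ∧ σ * ρ * σ⁻¹ = ρ ^ r) ∧
    CyclicallyPermutes σ (orbits ρ)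

/-- `X` is an `(m, n)`-metacirculant relative to the ordered pair `(ρ, σ)`. -/
def IsMetacirculantRel (X : SimpleGraph V) (m n : ℕ) (ρ σ : X ≃g X) : Prop :=
  IsWeakMetacirculantRel X m n ρ σ ∧ ∃ v : V, (σ ^ m) v = v

/-- `X` is an `(m, n)`-metacirculant. -/
def IsMetacirculant (X : SimpleGraph V) (m n : ℕ) : Prop :=
  ∃ ρ σ : X ≃g X, IsMetacirculantRel X m n ρ σ

/-- The sets `O` and `P` of vertices are joined by an edge of `X`. -/
def Joined (X : SimpleGraph V) (O P : Set V) : Prop :=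
  ∃ x ∈ O, ∃ y ∈ P, X.Adj x y

/-- `X` is a weak `(m, n)`-metacirculant of Class II relative to `(ρ, σ)`: every vertex has two
neighbours in its own orbit under `ρ`, and each orbit is joined to exactly two other orbits, to each
of them with a single edge of the quotient multigraph (each vertex of the one orbit has exactly one
neighbour in the other). -/
def IsClassIIRel (X : SimpleGraph V) (m n : ℕ) (ρ σ : X ≃g X) : Prop :=
  IsWeakMetacirculantRel X m n ρ σ ∧
  (∀ O ∈ orbits ρ, ∀ x ∈ O, (X.neighborSet x ∩ O).ncard = 2) ∧
  ∀ O ∈ orbits ρ,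
    {P | P ∈ orbits ρ ∧ P ≠ O ∧ Joined X O P}.ncard = 2 ∧
    ∀ P ∈ orbits ρ, P ≠ O → Joined X O P → ∀ x ∈ O, (X.neighborSet x ∩ P).ncard = 1

end HalfArc

/-!
Let `D` be one of the two orientations of `X` that `Aut X` preserves. Each vertex `x` has exactly one
out-neighbour `S x` in its own `ρ`-orbit, and exactly one other out-neighbour `F x`, which lies in the
next `ρ`-orbit. The permutations `F` and `S` commute with `ρ` and `σ`, and from any vertex they reach
all the others. So everything is governed by a few elements of `ZMod n`: the step `s` of `S`, the
factor `q` by which the step changes from one orbit to the next, and `t` with `F ^ m = ρ ^ t`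
(`SpiralSystem`). A suitable `ρ ^ k * σ` has order `m` as soon as `i * R + t = 0` has a solution `i`,
where `R = 1 + q + ⋯ + q ^ (m - 1)` (`IsLeveling.exists_pow_mul`).

Half-arc-transitivity yields an automorphism `g` of the oriented graph that fixes a vertex and
exchanges its two out-neighbours. Since the conjugates of `S` by `F` commute with `S`, there are closed
walks of length eight of a certain pattern, and looking at their images under `g` shows that `g`
exchanges the two kinds of arcs everywhere (`SpiralSystem.SwapsAt.all`), except in a case with `m = 4`
where the equation is solvable (`SpiralSystem.exists_of_exceptional`). A global exchange means that
`g` conjugates `F` to `S` and `S` to `F`. Comparing orders and commutators gives that `s` is a unit,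
`m ∣ n`, `(q - 1) ^ 2 = 0`, that `t` and `q - 1` are multiples of `m`, and a relation between the two.

With these facts (`SpiralSystem.dichotomy`) either the equation is solvable, or `(q - 1) * s` is a
multiple of `c = s * R - t` and `2 * s` is not. Now `F⁻¹ * S` carries each tail of an alternating cycle to a neighbouring
tail of it, and its `m`-th power is the rotation by `c`. In the second case `S` therefore permutes the
cycles of `F⁻¹ * S`, so that the heads of each alternating cycle are the tails of another one, and the
graph is tightly attached (`isTightlyAttached_of_sameCycle`).
-/

namespace HalfArc

open scoped Pointwise

variable {V : Type*}

/-! ### Spiral systems -/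

/-- The combinatorial data of an oriented weak metacirculant of Class II. Every vertex `x` has the two
out-neighbours `S x`, in its own orbit under the rotations, and `F x`, in the orbit that is one level
higher; there are `m` levels in cyclic order, and on each of them `ZMod n` acts regularly by `rot`.

The number `q` tells how the step `sh x` of `S` changes from one level to the next, and `t` is the
rotation by which a climb through all `m` levels fails to close up. -/
structure SpiralSystem (V : Type*) (m n : ℕ) where
  rot : ZMod n → Equiv.Perm V
  F : Equiv.Perm V
  S : Equiv.Perm V
  sh : V → ZMod n
  lev : V → ZMod m
  q : ZMod n
  t : ZMod n
  rot_zero : ∀ x, rot 0 x = x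
  rot_add : ∀ a b x, rot (a + b) x = rot a (rot b x)
  rot_inj : ∀ {a b x}, rot a x = rot b x → a = b
  F_rot : ∀ a x, F (rot a x) = rot a (F x)
  S_eq : ∀ x, S x = rot (sh x) x
  sh_rot : ∀ a x, sh (rot a x) = sh x
  sh_F : ∀ x, sh (F x) = q * sh x
  lev_rot : ∀ a x, lev (rot a x) = lev x
  lev_F : ∀ x, lev (F x) = lev x + 1
  exists_rot : ∀ {x y}, lev x = lev y → ∃ a, rot a x = y
  F_pow_m : ∀ x, (F ^ m) x = rot t x
  q_mul_t : q * t = t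
  generated : ∀ (P : V → Prop) (x₀ : V), P x₀ → (∀ x, P x → P (F x)) → (∀ x, P x → P (S x)) →
    ∀ x, P x

namespace SpiralSystem

variable {m n : ℕ} (Z : SpiralSystem V m n)

lemma S_rot (a : ZMod n) (x : V) : Z.S (Z.rot a x) = Z.rot a (Z.S x) := by
  rw [Z.S_eq, Z.S_eq, Z.sh_rot, ← Z.rot_add, ← Z.rot_add, add_comm]

lemma sh_S (x : V) : Z.sh (Z.S x) = Z.sh x := by rw [Z.S_eq, Z.sh_rot]

lemma lev_S (x : V) : Z.lev (Z.S x) = Z.lev x := by rw [Z.S_eq, Z.lev_rot]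

lemma rot_eq_self {a : ZMod n} {x : V} : Z.rot a x = x ↔ a = 0 :=
  ⟨fun h => Z.rot_inj (h.trans (Z.rot_zero x).symm), fun h => h ▸ Z.rot_zero x⟩

lemma F_pow_rot (i : ℕ) (a : ZMod n) (x : V) :
    (Z.F ^ i) (Z.rot a x) = Z.rot a ((Z.F ^ i) x) := by
  induction i with
  | zero => rfl
  | succ i ih => rw [pow_succ', Equiv.Perm.mul_apply, Equiv.Perm.mul_apply, ih, Z.F_rot]

lemma sh_F_pow (i : ℕ) (x : V) : Z.sh ((Z.F ^ i) x) = Z.q ^ i * Z.sh x := by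
  induction i with
  | zero => simp
  | succ i ih => rw [pow_succ', Equiv.Perm.mul_apply, Z.sh_F, ih]; ring

lemma lev_F_pow (i : ℕ) (x : V) : Z.lev ((Z.F ^ i) x) = Z.lev x + i := by
  induction i with
  | zero => simp
  | succ i ih => rw [pow_succ', Equiv.Perm.mul_apply, Z.lev_F, ih]; push_cast; ring

lemma S_pow (i : ℕ) (x : V) : (Z.S ^ i) x = Z.rot (i * Z.sh x) x := by
  induction i with
  | zero => simp [Z.rot_zero]
  | succ i ih =>
    rw [pow_succ', Equiv.Perm.mul_apply, ih, Z.S_rot, Z.S_eq, ← Z.rot_add]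
    congr 2; push_cast; ring

lemma F_pow_mul (k : ℕ) (x : V) : (Z.F ^ (m * k)) x = Z.rot (k * Z.t) x := by
  induction k with
  | zero => simp [Z.rot_zero]
  | succ k ih =>
    rw [mul_add, pow_add, Equiv.Perm.mul_apply, mul_one, Z.F_pow_m, Z.F_pow_rot, ih, ← Z.rot_add]
    congr 2; push_cast; ring

lemma exists_F_pow_rot (x y : V) : ∃ (i : ℕ) (a : ZMod n), y = (Z.F ^ i) (Z.rot a x) := by
  refine Z.generated (fun y => ∃ (i : ℕ) (a : ZMod n), y = (Z.F ^ i) (Z.rot a x)) x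
    ⟨0, 0, by simp [Z.rot_zero]⟩ ?_ ?_ y
  · rintro y ⟨i, a, rfl⟩
    exact ⟨i + 1, a, by rw [pow_succ', Equiv.Perm.mul_apply]⟩
  · rintro y ⟨i, a, rfl⟩
    refine ⟨i, Z.sh ((Z.F ^ i) (Z.rot a x)) + a, ?_⟩
    rw [Z.S_eq, ← Z.F_pow_rot, ← Z.rot_add]

/-- Every vertex is reached from `x` by steps `F` and `S`, so the rotation steps met on the way,
which are multiples of `Z.sh x`, generate `ZMod n` together with `Z.t`. -/
lemma isCoprime_sh_t (x : V) : IsCoprime (Z.sh x) Z.t := by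
  have key : ∀ y, ∃ (i : ℕ) (a : ZMod n), y = (Z.F ^ i) (Z.rot (a * Z.sh x) x) := by
    refine fun y => Z.generated (fun y => ∃ (i : ℕ) (a : ZMod n), y = (Z.F ^ i)
      (Z.rot (a * Z.sh x) x)) x ⟨0, 0, by simp [Z.rot_zero]⟩ ?_ ?_ y
    · rintro y ⟨i, a, rfl⟩
      exact ⟨i + 1, a, by rw [pow_succ', Equiv.Perm.mul_apply]⟩
    · rintro y ⟨i, a, rfl⟩
      refine ⟨i, Z.q ^ i + a, ?_⟩
      rw [Z.S_eq, ← Z.F_pow_rot, ← Z.rot_add, Z.sh_F_pow, Z.sh_rot, add_mul]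
  obtain ⟨i, a, h⟩ := key (Z.rot 1 x)
  have hi : (i : ZMod m) = 0 := by
    have := congrArg Z.lev h
    rw [Z.lev_F_pow, Z.lev_rot, Z.lev_rot] at this
    simpa using this
  obtain ⟨k, rfl⟩ := (ZMod.natCast_eq_zero_iff i m).1 hi
  rw [Z.F_pow_mul, ← Z.rot_add] at h
  exact ⟨a, k, by rw [Z.rot_inj h]; ring⟩

lemma q_pow_m (x : V) : Z.q ^ m = 1 := by
  have h1 : Z.q ^ m * Z.sh x = Z.sh x := by rw [← Z.sh_F_pow, Z.F_pow_m, Z.sh_rot]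
  have h2 : ∀ i : ℕ, Z.q ^ i * Z.t = Z.t := by
    intro i
    induction i with
    | zero => simp
    | succ i ih => rw [pow_succ, mul_assoc, Z.q_mul_t, ih]
  obtain ⟨a, b, h⟩ := Z.isCoprime_sh_t x
  linear_combination a * h1 + b * h2 m - (Z.q ^ m - 1) * h

lemma isUnit_q (hm : m ≠ 0) (x : V) : IsUnit Z.q := IsUnit.of_pow_eq_one (Z.q_pow_m x) hm

/-- The sum of all steps `Z.sh` met on a climb through the `m` levels, relative to the first one. -/
def R : ZMod n := ∑ i ∈ Finset.range m, Z.q ^ i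

lemma q_mul_R (x : V) : Z.q * Z.R = Z.R := by
  have h := geom_sum_mul Z.q m
  rw [Z.q_pow_m x, sub_self] at h
  unfold R
  linear_combination h

/-! ### Automorphisms that exchange the two out-neighbours of a vertex -/

/-- `g` is an automorphism of the digraph with the arcs `(x, F x)` and `(x, S x)`. -/
def IsAut (g : Equiv.Perm V) : Prop :=
  ∀ x, (g (Z.F x) = Z.F (g x) ∧ g (Z.S x) = Z.S (g x)) ∨
    (g (Z.F x) = Z.S (g x) ∧ g (Z.S x) = Z.F (g x))

/-- `g` exchanges the two kinds of arcs that start at `x`. -/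
def SwapsAt (g : Equiv.Perm V) (x : V) : Prop :=
  g (Z.F x) = Z.S (g x) ∧ g (Z.S x) = Z.F (g x)

/-- Since rotations by `Z.sh x` and `Z.sh (F x)` commute, there is a closed walk of length eight
that starts with `x, S x, F (S x)`. Its image under `g` starts with `g x, F (g x)`, and `lev` leaves
only one way to close it after another step along `F`; that needs `m = 4`. -/
lemma SwapsAt.S_or {Z : SpiralSystem V m n} (hm : 3 ≤ m) {g : Equiv.Perm V} (hg : Z.IsAut g) {x : V}
    (hx : Z.SwapsAt g x) :
    Z.SwapsAt g (Z.S x) ∨ m = 4 ∧ Z.t = 2 * Z.sh (g x) * (1 + Z.q ^ 3) := by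
  rcases hg (Z.S x) with h1 | h1
  swap
  · exact Or.inl h1
  right
  have hnat : ∀ k : ℕ, (k : ZMod m) = 0 → m ∣ k := fun k h => (ZMod.natCast_eq_zero_iff k m).1 h
  have h10 : (1 : ZMod m) ≠ 0 := by
    intro h; have := Nat.le_of_dvd (by norm_num) (hnat 1 (by exact_mod_cast h)); omega
  have h20 : (2 : ZMod m) ≠ 0 := by
    intro h; have := Nat.le_of_dvd (by norm_num) (hnat 2 (by exact_mod_cast h)); omega
  set y := g x with hy
  set z := Z.rot (Z.sh (Z.F x)) x with hz
  have e1 : Z.F z = Z.S (Z.F x) := by rw [hz, Z.F_rot, Z.S_eq (Z.F x)]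
  have e2 : Z.F (Z.S z) = Z.S (Z.F (Z.S x)) := by
    rw [hz, Z.S_rot, Z.F_rot, Z.S_eq x, Z.F_rot, Z.S_rot, Z.S_eq (Z.F x), ← Z.rot_add, ← Z.rot_add,
      add_comm]
  set w := g z with hw
  have lz : Z.lev z = Z.lev x := by rw [hz, Z.lev_rot]
  have hne1 : w ≠ Z.S y := by
    rw [hw, ← hx.1]
    intro h
    have := congrArg Z.lev (g.injective h)
    rw [Z.lev_F, lz] at this
    exact h10 (by simpa using this.symm)
  have hne2 : g (Z.S z) ≠ Z.F (Z.F y) := by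
    rw [← hx.2, ← h1.1]
    intro h
    have := congrArg Z.lev (g.injective h)
    rw [Z.lev_F, Z.lev_S, Z.lev_S, lz] at this
    exact h10 (by simpa using this.symm)
  have c1 : (Z.F w = Z.S (Z.S y) ∧ g (Z.S z) = Z.S w) ∨
      (Z.S w = Z.F (Z.S y) ∧ g (Z.S z) = Z.F w) := by
    have e := congrArg g e1
    rcases hg z with h | h <;> rcases hg (Z.F x) with h' | h' <;> rw [h.1, h'.2, hx.1] at e
    · exact Or.inl ⟨e, h.2⟩
    · exact absurd (Z.F.injective e) hne1
    · exact absurd (Z.S.injective e) hne1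
    · exact Or.inr ⟨e, h.2⟩
  have c2 : Z.F (g (Z.S z)) = Z.S (Z.F (Z.F y)) ∨ Z.S (g (Z.S z)) = Z.F (Z.F (Z.F y)) := by
    have e := congrArg g e2
    rcases hg (Z.S z) with h | h <;> rcases hg (Z.F (Z.S x)) with h' | h' <;>
      rw [h.1, h'.2, h1.1, hx.2] at e
    · exact Or.inl e
    · exact absurd (Z.F.injective e) hne2
    · exact absurd (Z.S.injective e) hne2
    · exact Or.inr e
  -- all combinations but one are excluded by comparing levels
  rcases c1 with ⟨c1, d1⟩ | ⟨c1, d1⟩ <;> rcases c2 with c2 | c2 <;> rw [d1] at c2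
  · exfalso
    have l1 := congrArg Z.lev c1
    have l2 := congrArg Z.lev c2
    simp only [Z.lev_F, Z.lev_S] at l1 l2
    exact h20 (by linear_combination l1 - l2)
  · have l1 := congrArg Z.lev c1
    have l2 := congrArg Z.lev c2
    simp only [Z.lev_F, Z.lev_S] at l1 l2
    have h40 : (4 : ZMod m) = 0 := by linear_combination l1 - l2
    have hm4 : m = 4 := by
      have h4 := hnat 4 (by exact_mod_cast h40)
      have := Nat.le_of_dvd (by norm_num) h4
      rcases (by omega : m = 3 ∨ m = 4) with h | h
      · rw [h] at h4
        omega
      · exact h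
    refine ⟨hm4, ?_⟩
    have s1 := congrArg Z.sh c1
    simp only [Z.sh_F, Z.sh_S] at s1
    have e := congrArg Z.F c2
    have e4 : Z.F (Z.F (Z.F (Z.F y))) = Z.rot Z.t y := by
      rw [← Z.F_pow_m y]
      exact congrArg (fun k => (Z.F ^ k) y) hm4.symm
    rw [e4, Z.S_eq (Z.S w), Z.S_eq w, Z.F_rot, Z.F_rot, c1, Z.S_eq (Z.S y), Z.S_eq y] at e
    simp only [Z.sh_rot, ← Z.rot_add] at e
    have hq : Z.q ^ 4 = 1 := (congrArg (Z.q ^ ·) hm4.symm).trans (Z.q_pow_m x)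
    have ht := Z.rot_inj e
    linear_combination -ht + 2 * Z.q ^ 3 * s1 - 2 * Z.sh w * hq
  · exfalso
    have l1 := congrArg Z.lev c1
    have l2 := congrArg Z.lev c2
    simp only [Z.lev_F, Z.lev_S] at l1 l2
    exact h10 (by linear_combination l2 - l1)
  · exfalso
    have l1 := congrArg Z.lev c1
    have l2 := congrArg Z.lev c2
    simp only [Z.lev_F, Z.lev_S] at l1 l2
    exact h10 (by linear_combination l1 - l2)

lemma IsAut.inv {Z : SpiralSystem V m n} {g : Equiv.Perm V} (hg : Z.IsAut g) : Z.IsAut g⁻¹ := by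
  intro x
  have e : g (g⁻¹ x) = x := g.apply_symm_apply x
  rcases hg (g⁻¹ x) with h | h <;> rw [e] at h
  · left
    exact ⟨by rw [← h.1]; simp, by rw [← h.2]; simp⟩
  · right
    exact ⟨by rw [← h.2]; simp, by rw [← h.1]; simp⟩

lemma SwapsAt.inv {Z : SpiralSystem V m n} {g : Equiv.Perm V} {x : V} (hx : Z.SwapsAt g x) :
    Z.SwapsAt g⁻¹ (g x) := by
  have e : g⁻¹ (g x) = x := g.symm_apply_apply x
  exact ⟨by rw [e, ← hx.2]; simp, by rw [e, ← hx.1]; simp⟩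

/-- If the exceptional relation for `m = 4` does not hold, then an automorphism that exchanges the
two kinds of arcs somewhere does so everywhere. -/
lemma SwapsAt.all {Z : SpiralSystem V m n} (hm : 3 ≤ m)
    (h4 : ∀ y, ¬ (m = 4 ∧ Z.t = 2 * Z.sh y * (1 + Z.q ^ 3)))
    {g : Equiv.Perm V} (hg : Z.IsAut g) {x₀ : V} (hx₀ : Z.SwapsAt g x₀) (x : V) :
    Z.SwapsAt g x := by
  refine Z.generated (Z.SwapsAt g) x₀ hx₀ ?_ ?_ x
  · intro x hx
    have h := (hx.inv.S_or hm hg.inv).resolve_right (h4 _)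
    rw [← hx.1] at h
    simpa using h.inv
  · intro x hx
    exact (hx.S_or hm hg).resolve_right (h4 _)

/-- In the exceptional case one has `R = 2 (1 + q)`, because `2 (q ^ 2 - 1) = 0`. -/
lemma exists_of_exceptional [NeZero n] (Z : SpiralSystem V m n) (y : V) (hm : m = 4)
    (ht : Z.t = 2 * Z.sh y * (1 + Z.q ^ 3)) : ∃ k, k * Z.R + Z.t = 0 := by
  subst hm
  have hco := Z.isCoprime_sh_t y
  have hu : IsUnit (Z.sh y) := by
    obtain ⟨a, b, h⟩ := hco
    exact IsUnit.of_mul_eq_one (a + b * (2 * (1 + Z.q ^ 3))) (by rw [ht] at h; linear_combination h)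
  have hq4 : Z.q ^ 4 = 1 := Z.q_pow_m y
  have hqu : IsUnit Z.q := Z.isUnit_q (by omega) y
  have h1 : 2 * (Z.q ^ 2 - 1) = 0 := by
    have h := Z.q_mul_t
    rw [ht] at h
    have h2 : Z.sh y * (Z.q * (2 * (Z.q ^ 2 - 1))) = 0 := by
      linear_combination -h + 2 * Z.sh y * hq4
    exact (hqu.mul_right_eq_zero).1 ((hu.mul_right_eq_zero).1 h2)
  have h2 : (1 + Z.q) * (Z.q ^ 2 - 1) = 0 := by
    rcases Nat.even_or_odd n with hn | hn
    · obtain ⟨l, hl⟩ : ∃ l : ZMod n, 1 + Z.q = l * 2 := by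
        have hc := (ZMod.isUnit_iff_coprime Z.q.val n).1 (by simpa using hqu)
        have ho : Odd Z.q.val := by
          rw [← Nat.not_even_iff_odd]
          intro he
          have := Nat.dvd_gcd he.two_dvd hn.two_dvd
          rw [hc] at this
          omega
        obtain ⟨j, hj⟩ := ho
        refine ⟨j + 1, ?_⟩
        rw [← ZMod.natCast_zmod_val Z.q, hj]
        push_cast; ring
      rw [hl]
      linear_combination l * h1
    · have h2u : IsUnit (2 : ZMod n) := by
        have := (ZMod.isUnit_iff_coprime 2 n).2 (Nat.coprime_two_left.2 hn)
        simpa using this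
      rw [(h2u.mul_right_eq_zero).1 h1, mul_zero]
  refine ⟨-Z.sh y, ?_⟩
  have hR : Z.R = 1 + Z.q + Z.q ^ 2 + Z.q ^ 3 := by
    unfold R
    simp [Finset.sum_range_succ]
  rw [hR, ht]
  linear_combination (Z.sh y * Z.q) * h1 - Z.sh y * h2

/-! ### Consequences of a global exchange -/

end SpiralSystem

/-- The number theory behind the dichotomy below. The first alternative can only fail if `l` is twice
an odd number, and then the second one holds modulo both factors. -/
lemma int_dichotomy (m l : ℕ) (k v : ℤ) (h1 : (l : ℤ) ∣ m * k) (h2 : (l : ℤ) ∣ k * (v + 1))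
    (h3 : 2 ∣ l → ¬ (2 : ℤ) ∣ v) :
    (∃ i, (l : ℤ) ∣ i * (1 + k * (m * (m - 1) / 2 : ℕ)) + v) ∨
      ∃ j, (l : ℤ) ∣ j * (1 + k * (m * (m - 1) / 2 : ℕ) - v) - k := by
  rcases Nat.even_or_odd' m with ⟨m', rfl | rfl⟩
  swap
  · left
    refine ⟨-v, ?_⟩
    have e : (2 * m' + 1) * (2 * m' + 1 - 1) / 2 = (2 * m' + 1) * m' := by
      rw [show (2 * m' + 1) * (2 * m' + 1 - 1) = (2 * m' + 1) * m' * 2 by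
        rw [Nat.add_sub_cancel]; ring, Nat.mul_div_cancel _ (by norm_num)]
    rw [e]
    obtain ⟨c, hc⟩ := h1
    refine ⟨-v * m' * c, ?_⟩
    push_cast at hc ⊢
    linear_combination -v * m' * hc
  rcases Nat.eq_zero_or_pos m' with rfl | hm'
  · left
    exact ⟨-v, by simp⟩
  obtain ⟨o, ho⟩ : ∃ o : ℕ, 2 * m' - 1 = 2 * o + 1 := ⟨m' - 1, by omega⟩
  have e : 2 * m' * (2 * m' - 1) / 2 = m' * (2 * o + 1) := by
    rw [ho, show 2 * m' * (2 * o + 1) = m' * (2 * o + 1) * 2 by ring,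
      Nat.mul_div_cancel _ (by norm_num)]
  rw [e]
  by_cases hd : (l : ℤ) ∣ m' * k
  · left
    refine ⟨-v, ?_⟩
    obtain ⟨c, hc⟩ := hd
    refine ⟨-v * (2 * o + 1) * c, ?_⟩
    push_cast
    linear_combination -v * (2 * o + 1) * hc
  -- now `m' * k` is an odd multiple of half of `l`
  obtain ⟨w, hw⟩ := h1
  have hlw : ¬ (2 : ℤ) ∣ w := by
    rintro ⟨w', rfl⟩
    refine hd ⟨w', ?_⟩
    push_cast at hw
    linarith
  have hl2 : (2 : ℤ) ∣ l := by
    have : (2 : ℤ) ∣ l * w := ⟨m' * k, by rw [← hw]; push_cast; ring⟩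
    exact (Int.prime_two.dvd_or_dvd this).resolve_right hlw
  obtain ⟨h, rfl⟩ : 2 ∣ l := by exact_mod_cast hl2
  have hmk : (m' : ℤ) * k = h * w := by push_cast at hw; linarith
  have hv := h3 ⟨h, rfl⟩
  have hR : (1 : ℤ) + k * (m' * (2 * o + 1) : ℕ) = 1 + h * (w * (2 * o + 1)) := by
    push_cast; linear_combination (2 * (o : ℤ) + 1) * hmk
  rw [hR]
  rcases Nat.even_or_odd' h with ⟨h', rfl | rfl⟩
  · -- `1 + h * _` is a unit modulo `2 * h`, because its square is `1`
    left
    refine ⟨-v * (1 + (2 * h' : ℕ) * (w * (2 * o + 1))), -v * (w * (2 * o + 1)) *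
      (1 + h' * (w * (2 * o + 1))), ?_⟩
    push_cast; ring
  · right
    have hk : ¬ (2 : ℤ) ∣ k := by
      intro hk
      have h5 : (2 : ℤ) ∣ (2 * h' + 1 : ℕ) * w := hmk ▸ hk.mul_left _
      rcases Int.prime_two.dvd_or_dvd h5 with h6 | h6
      · push_cast at h6; omega
      · exact hlw h6
    have hcop : IsCoprime (2 : ℤ) (2 * h' + 1 : ℕ) := ⟨-h', 1, by push_cast; ring⟩
    -- `j` is odd and congruent to `k / 2` modulo `h`
    obtain ⟨k', rfl⟩ : ∃ k', k = 2 * k' + 1 := ⟨k / 2, by omega⟩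
    obtain ⟨v', rfl⟩ : ∃ v', v = 2 * v' + 1 := ⟨v / 2, by omega⟩
    obtain ⟨w', rfl⟩ : ∃ w', w = 2 * w' + 1 := ⟨w / 2, by omega⟩
    obtain ⟨c, hc⟩ := (Dvd.intro_left _ rfl : ((2 * h' + 1 : ℕ) : ℤ) ∣ (2 : ℕ) *
      ((2 * h' + 1 : ℕ) : ℤ)).trans (by exact_mod_cast h2)
    refine ⟨(k' + h' + 1) + (2 * h' + 1 : ℕ) * (k' + h'), ?_⟩
    rw [Nat.cast_mul]
    refine hcop.mul_dvd ?_ (hcop.symm.dvd_of_dvd_mul_left ?_)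
    · have oj : Odd ((k' + h' + 1) + (2 * h' + 1 : ℕ) * (k' + h')) :=
        ⟨k' + h' + h' * (k' + h'), by push_cast; ring⟩
      have oh : Odd ((2 * h' + 1 : ℕ) * ((2 * w' + 1) * (2 * o + 1)) : ℤ) :=
        Odd.mul ⟨h', by push_cast; ring⟩ (Odd.mul ⟨w', rfl⟩ ⟨o, rfl⟩)
      have oR := (odd_one.add_odd oh).sub_odd ⟨v', rfl⟩
      exact ((oj.mul oR).sub_odd ⟨k', rfl⟩).two_dvd
    · refine ⟨(1 + 2 * (k' + h')) * (1 + (2 * h' + 1 : ℕ) * ((2 * w' + 1) * (2 * o + 1)) -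
        (2 * v' + 1)) + (2 * k' + 1) * ((2 * w' + 1) * (2 * o + 1)) - c, ?_⟩
      push_cast at hc ⊢
      linear_combination -hc

namespace SpiralSystem

variable {m n : ℕ} (Z : SpiralSystem V m n)

/-- If `g` exchanges the two kinds of arcs everywhere, then it conjugates `S` to `F`, so the same
powers of `S` and `F` are trivial. -/
lemma S_pow_eq_one_iff {Z : SpiralSystem V m n} {g : Equiv.Perm V} (hg : ∀ x, Z.SwapsAt g x)
    (j : ℕ) : Z.S ^ j = 1 ↔ Z.F ^ j = 1 := by
  have hc : Z.F = g * Z.S * g⁻¹ := by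
    ext x
    have := (hg (g⁻¹ x)).2
    simpa using this.symm
  rw [hc, conj_pow, conj_eq_one_iff]

lemma S_pow_eq_one_iff_sh (j : ℕ) (x : V) : Z.S ^ j = 1 ↔ (j : ZMod n) * Z.sh x = 0 := by
  refine ⟨fun h => ?_, fun h => ?_⟩
  · rw [← Z.rot_eq_self (x := x), ← Z.S_pow, h]; rfl
  · ext y
    obtain ⟨i, a, rfl⟩ := Z.exists_F_pow_rot x y
    rw [Z.S_pow, Z.sh_F_pow, Z.sh_rot, Equiv.Perm.one_apply, Z.rot_eq_self]
    linear_combination Z.q ^ i * h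

lemma dvd_of_F_pow_eq_one {j : ℕ} (x : V) (h : Z.F ^ j = 1) : m ∣ j := by
  have := Z.lev_F_pow j x
  rw [h, Equiv.Perm.one_apply, left_eq_add] at this
  exact (ZMod.natCast_eq_zero_iff j m).1 this

lemma F_pow_mul_eq_one_iff (k : ℕ) (x : V) : Z.F ^ (m * k) = 1 ↔ (k : ZMod n) * Z.t = 0 := by
  refine ⟨fun h => ?_, fun h => ?_⟩
  · rw [← Z.rot_eq_self (x := x), ← Z.F_pow_mul, h]; rfl
  · ext y
    rw [Z.F_pow_mul, h, Z.rot_zero, Equiv.Perm.one_apply]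

section Swap

variable {Z} {g : Equiv.Perm V}

lemma dvd_of_mul_sh (hg : ∀ x, Z.SwapsAt g x) {x : V} {j : ℕ} (h : (j : ZMod n) * Z.sh x = 0) :
    m ∣ j :=
  Z.dvd_of_F_pow_eq_one x ((S_pow_eq_one_iff hg j).1 ((Z.S_pow_eq_one_iff_sh j x).2 h))

lemma mul_sh_iff_mul_t (hg : ∀ x, Z.SwapsAt g x) (x : V) (k : ℕ) :
    ((m * k : ℕ) : ZMod n) * Z.sh x = 0 ↔ (k : ZMod n) * Z.t = 0 := by
  rw [← Z.S_pow_eq_one_iff_sh, S_pow_eq_one_iff hg, Z.F_pow_mul_eq_one_iff k x]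

/-- `S` and `F` have orders `n / gcd (sh x, n)` and `m * n / gcd (t, n)`. These are equal, so
`gcd (sh x, n)` divides `gcd (t, n)`, while `sh x` and `t` are coprime modulo `n`. -/
lemma isUnit_sh [NeZero n] (hg : ∀ x, Z.SwapsAt g x) (x : V) : IsUnit (Z.sh x) := by
  obtain ⟨s, hs⟩ : ∃ s : ℕ, (s : ZMod n) = Z.sh x := ⟨_, ZMod.natCast_zmod_val _⟩
  obtain ⟨t, ht⟩ : ∃ t : ℕ, (t : ZMod n) = Z.t := ⟨_, ZMod.natCast_zmod_val _⟩
  have hn := NeZero.ne n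
  rw [← hs, ZMod.isUnit_iff_coprime]
  by_contra hnc
  obtain ⟨p, hp, hps, ⟨l, hl⟩⟩ := Nat.Prime.not_coprime_iff_dvd.1 hnc
  have h1 : ((l : ℕ) : ZMod n) * Z.sh x = 0 := by
    rw [← hs, ← Nat.cast_mul, ZMod.natCast_eq_zero_iff, hl, mul_comm p]
    exact mul_dvd_mul_left l hps
  obtain ⟨k, rfl⟩ := dvd_of_mul_sh hg h1
  have hk : k ≠ 0 := by rintro rfl; simp at hl; exact hn hl
  have h2 := (mul_sh_iff_mul_t hg x k).1 h1
  rw [← ht, ← Nat.cast_mul, ZMod.natCast_eq_zero_iff, hl] at h2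
  have hpt : p ∣ t := by
    have h3 : k * (p * m) ∣ k * t := by convert h2 using 1; ring
    exact (dvd_mul_right p m).trans (Nat.dvd_of_mul_dvd_mul_left (Nat.pos_of_ne_zero hk) h3)
  obtain ⟨a, b, h⟩ := Z.isCoprime_sh_t x
  have hpn : p ∣ n := ⟨_, hl⟩
  have h' := congrArg (ZMod.castHom hpn (ZMod p)) h
  rw [← hs, ← ht, map_add, map_mul, map_mul, map_natCast, map_natCast, map_one,
    (ZMod.natCast_eq_zero_iff s p).2 hps, (ZMod.natCast_eq_zero_iff t p).2 hpt] at h'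
  have := Fact.mk hp
  simp at h'

lemma m_dvd_n [NeZero n] (hg : ∀ x, Z.SwapsAt g x) (x : V) : m ∣ n :=
  dvd_of_mul_sh hg (x := x) (by simp)

/-- `q - 1` is nilpotent: the swap turns the fact that `S` commutes with its conjugate by `F` into
the fact that `F` commutes with its conjugate by `S`. -/
lemma q_sub_one_sq [NeZero n] (hg : ∀ x, Z.SwapsAt g x) (x : V) : (Z.q - 1) ^ 2 = 0 := by
  set y := g x with hy
  set z := Z.rot (Z.sh (Z.F x)) x with hz
  have e1 : Z.F z = Z.S (Z.F x) := by rw [hz, Z.F_rot, Z.S_eq (Z.F x)]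
  have e2 : Z.F (Z.S z) = Z.S (Z.F (Z.S x)) := by
    rw [hz, Z.S_rot, Z.F_rot, Z.S_eq x, Z.F_rot, Z.S_rot, Z.S_eq (Z.F x), ← Z.rot_add, ← Z.rot_add,
      add_comm]
  apply_fun g at e1 e2
  rw [(hg _).1, (hg _).2, (hg _).1] at e1
  rw [(hg _).1, (hg _).2, (hg _).2, (hg _).1, (hg _).2] at e2
  obtain ⟨b, hb⟩ : ∃ b, Z.rot b (Z.F y) = g z := by
    refine Z.exists_rot ?_
    have := congrArg Z.lev e1
    rwa [Z.lev_S, Z.lev_F, Z.lev_S, ← Z.lev_F, eq_comm] at this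
  rw [← hb, Z.S_rot, Z.S_eq, Z.S_eq (g x), Z.F_rot, ← Z.rot_add] at e1
  rw [← hb, Z.F_rot, Z.S_rot, Z.S_eq, Z.S_eq (Z.F (g x)), Z.F_rot, ← Z.rot_add] at e2
  have e1 := Z.rot_inj e1
  have e2 := Z.rot_inj e2
  simp only [Z.sh_F] at e1 e2
  refine ((isUnit_sh hg y).mul_right_eq_zero).1 ?_
  linear_combination e2 - e1

/-- The commutator of `F` and `S` is a power of `S`, hence by the swap also a power of `F`. Being
level-preserving, it is a power of `F ^ m`. -/
lemma exists_q_eq [NeZero n] (hg : ∀ x, Z.SwapsAt g x) (x : V) :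
    ∃ k : ℕ, Z.q = 1 + m * k ∧ (k : ZMod n) * Z.t + m * k * Z.sh x = 0 := by
  obtain ⟨e, he⟩ : ∃ e : ℕ, (e : ZMod n) = Z.q - 1 := ⟨_, ZMod.natCast_zmod_val _⟩
  have hsq := q_sub_one_sq hg x
  have h1 : ∀ y, Z.S (Z.F y) = (Z.S ^ e) (Z.F (Z.S y)) := by
    intro y
    rw [Z.S_pow, Z.S_eq (Z.F y), Z.S_eq y, Z.F_rot, Z.sh_rot, ← Z.rot_add, Z.sh_F, he]
    congr 2
    linear_combination -Z.sh y * hsq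
  have hS : ∀ (i : ℕ) (y : V), g ((Z.S ^ i) y) = (Z.F ^ i) (g y) := by
    intro i y
    induction i with
    | zero => rfl
    | succ i ih =>
      rw [pow_succ', pow_succ', Equiv.Perm.mul_apply, Equiv.Perm.mul_apply, (hg _).2, ih]
  have hgx : g (g⁻¹ x) = x := g.apply_symm_apply x
  have h2 := congrArg g (h1 (g⁻¹ x))
  rw [hS, (hg _).2, (hg _).1, (hg _).1, (hg _).2, hgx, h1, Z.S_pow] at h2
  have hl := congrArg Z.lev h2
  rw [Z.lev_F_pow, Z.lev_rot, left_eq_add] at hl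
  obtain ⟨k, rfl⟩ := (ZMod.natCast_eq_zero_iff e m).1 hl
  rw [Z.F_pow_mul, ← Z.rot_add, eq_comm, Z.rot_eq_self, he, Z.sh_F, Z.sh_S] at h2
  have hk : Z.q = 1 + m * k := by
    rw [Nat.cast_mul] at he
    linear_combination -he
  refine ⟨k, hk, ?_⟩
  linear_combination h2 - Z.sh x * hsq - Z.sh x * hk

/-- Multiplication by `n / m` kills `t`, so `t` is a multiple of `m`. If `n / m` and `v` were both even,
then multiplication by `n / (2 * m)` would kill it too, against `mul_sh_iff_mul_t`. -/
lemma exists_t_eq [NeZero n] (hm : m ≠ 0) (hg : ∀ x, Z.SwapsAt g x) (x : V) :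
    ∃ v : ℕ, Z.t = m * v * Z.sh x ∧ (2 * m ∣ n → ¬ 2 ∣ v) := by
  have hu := isUnit_sh hg x
  obtain ⟨l, hl⟩ := m_dvd_n hg x
  obtain ⟨t, ht⟩ : ∃ t : ℕ, (t : ZMod n) * Z.sh x = Z.t := by
    obtain ⟨w, hw⟩ := hu
    exact ⟨(Z.t * ((w⁻¹ : (ZMod n)ˣ) : ZMod n)).val, by simp [← hw]⟩
  have h1 : (l : ZMod n) * Z.t = 0 := (mul_sh_iff_mul_t hg x l).1 (by rw [← hl]; simp)
  have hl0 : 0 < l := Nat.pos_of_ne_zero (by rintro rfl; exact NeZero.ne n (by simpa using hl))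
  obtain ⟨v, rfl⟩ : m ∣ t := by
    rw [← ht, ← mul_assoc, hu.mul_left_eq_zero, ← Nat.cast_mul, ZMod.natCast_eq_zero_iff, hl,
      mul_comm m] at h1
    exact Nat.dvd_of_mul_dvd_mul_left hl0 h1
  refine ⟨v, by rw [← ht]; push_cast; ring, ?_⟩
  rintro ⟨i, hi⟩ ⟨w, rfl⟩
  have h2 : ((m * i : ℕ) : ZMod n) * Z.sh x = 0 := by
    rw [mul_sh_iff_mul_t hg, ← ht]
    have h3 : ((2 * m * i : ℕ) : ZMod n) = 0 := by rw [← hi]; simp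
    push_cast at h3 ⊢
    linear_combination (w * Z.sh x) * h3
  rw [hu.mul_left_eq_zero, ZMod.natCast_eq_zero_iff] at h2
  have hi0 : 0 < m * i := by
    refine Nat.mul_pos (Nat.pos_of_ne_zero hm) (Nat.pos_of_ne_zero ?_)
    rintro rfl
    exact NeZero.ne n (by simpa using hi)
  have := Nat.le_of_dvd hi0 h2
  have : n = 2 * (m * i) := by rw [hi]; ring
  omega

lemma q_pow_eq [NeZero n] (hg : ∀ x, Z.SwapsAt g x) (x : V) (i : ℕ) :
    Z.q ^ i = 1 + (Z.q - 1) * i := by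
  induction i with
  | zero => simp
  | succ i ih =>
    rw [pow_succ, ih]
    push_cast
    linear_combination (i : ZMod n) * q_sub_one_sq hg x

lemma R_eq [NeZero n] (hg : ∀ x, Z.SwapsAt g x) (x : V) :
    Z.R = m + (Z.q - 1) * (m * (m - 1) / 2 : ℕ) := by
  unfold R
  rw [Finset.sum_congr rfl fun i _ => q_pow_eq hg x i, Finset.sum_add_distrib, ← Finset.mul_sum,
    ← Nat.cast_sum, Finset.sum_range_id]
  simp

end Swap

/-- An alternating cycle with a tail `x` returns to the level of `x` first at the tail
`rot (c x) x`, see `A_pow_m`. -/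
def c (x : V) : ZMod n := Z.sh x * Z.R - Z.t

/-- The first alternative means that `F`, corrected by a rotation, closes up after `m` steps. In the
second one, `S` permutes the cycles of `A` (see `sameCycle_S_A`), and its square fixes none of them
(see `not_sameCycle`). -/
theorem dichotomy [NeZero n] (hm : 3 ≤ m) {g : Equiv.Perm V} (hg : Z.IsAut g) {x₀ : V}
    (hx₀ : Z.SwapsAt g x₀) :
    (∃ i, i * Z.R + Z.t = 0) ∨
      ∀ x, (∃ j : ℕ, (Z.q - 1) * Z.sh x = j * Z.c x) ∧ ∀ j : ZMod n, 2 * Z.sh x ≠ j * Z.c x := by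
  by_cases h4 : ∃ y, m = 4 ∧ Z.t = 2 * Z.sh y * (1 + Z.q ^ 3)
  · obtain ⟨y, h4, h5⟩ := h4
    exact Or.inl (Z.exists_of_exceptional y h4 h5)
  replace hg := fun x => hx₀.all hm (not_exists.1 h4) hg x
  rw [or_iff_not_imp_left]
  intro hno x
  obtain ⟨l, rfl⟩ := m_dvd_n hg x
  obtain ⟨k, hk, hkt⟩ := exists_q_eq hg x
  obtain ⟨v, hv, hodd⟩ := exists_t_eq (by omega) hg x
  have hu := isUnit_sh hg x
  have hm0 : (m : ℤ) ≠ 0 := by omega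
  have hR := R_eq hg x
  -- facts modulo `l` are facts about multiples of `m` modulo `m * l`
  have hdvd : ∀ i : ℤ, (l : ℤ) ∣ i ↔ (m : ZMod (m * l)) * i = 0 := by
    intro i
    have h1 : (m : ZMod (m * l)) * i = ((m * i : ℤ) : ZMod (m * l)) := by push_cast; rfl
    rw [h1, ZMod.intCast_zmod_eq_zero_iff_dvd, Nat.cast_mul, mul_dvd_mul_iff_left hm0]
  have h1 : (l : ℤ) ∣ m * k := by
    rw [hdvd]
    push_cast
    linear_combination Z.q_pow_m x - q_pow_eq hg x m - m * hk
  have h2 : (l : ℤ) ∣ k * (v + 1) := by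
    rw [hdvd]
    refine (hu.mul_left_eq_zero).1 ?_
    push_cast
    rw [hv] at hkt
    linear_combination hkt
  have h3 : 2 ∣ l → ¬ (2 : ℤ) ∣ v := fun h h' =>
    hodd (by rw [mul_comm]; exact mul_dvd_mul_left m h) (by exact_mod_cast h')
  have hdich := int_dichotomy m l k v h1 h2 h3
  generalize m * (m - 1) / 2 = b at hR hdich
  rcases hdich with ⟨i, hi⟩ | ⟨j, hj⟩
  · refine absurd ⟨i * Z.sh x, ?_⟩ hno
    rw [hdvd] at hi
    rw [hR, hk, hv]
    push_cast at hi
    linear_combination Z.sh x * hi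
  have hc : Z.c x = m * (Z.sh x * (1 + k * b - v)) := by
    unfold c
    rw [hR, hk, hv]
    ring
  refine ⟨⟨(j : ZMod (m * l)).val, ?_⟩, fun j' hj' => ?_⟩
  · rw [hdvd] at hj
    rw [ZMod.natCast_zmod_val, hc, hk]
    push_cast at hj
    linear_combination -Z.sh x * hj
  · rw [hc] at hj'
    obtain ⟨a, ha⟩ := hu.exists_left_inv
    have h := congrArg (fun b => ZMod.castHom (dvd_mul_right m l) (ZMod m) (a * b)) hj'
    have h5 : a * (2 * Z.sh x) = 2 := by linear_combination 2 * ha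
    simp only [h5, map_mul, map_natCast, CharP.cast_eq_zero, zero_mul, mul_zero, map_ofNat] at h
    have := Nat.le_of_dvd (by norm_num) ((ZMod.natCast_eq_zero_iff 2 m).1 (by exact_mod_cast h))
    omega

/-! ### The permutation that carries a tail of an alternating cycle to the next one -/

/-- Follow the arc to `S x`, and go back along the other arc that ends there. -/
def A : Equiv.Perm V := Z.F⁻¹ * Z.S

lemma F_A (x : V) : Z.F (Z.A x) = Z.S x := Z.F.apply_symm_apply _

lemma A_rot (a : ZMod n) (x : V) : Z.A (Z.rot a x) = Z.rot a (Z.A x) := by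
  apply Z.F.injective
  rw [Z.F_rot, F_A, F_A, S_rot]

lemma A_F (x : V) : Z.A (Z.F x) = Z.rot (Z.q * Z.sh x) x := by
  apply Z.F.injective
  rw [F_A, Z.S_eq, Z.sh_F, Z.F_rot]

lemma lev_A_pow (i : ℕ) (x : V) : Z.lev ((Z.A ^ i) x) + i = Z.lev x := by
  induction i with
  | zero => simp
  | succ i ih =>
    rw [pow_succ', Equiv.Perm.mul_apply, ← ih, ← Z.lev_S ((Z.A ^ i) x), ← F_A, Z.lev_F]
    push_cast; ring

lemma A_pow_rot (i : ℕ) (a : ZMod n) (x : V) :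
    (Z.A ^ i) (Z.rot a x) = Z.rot a ((Z.A ^ i) x) := by
  induction i with
  | zero => rfl
  | succ i ih => rw [pow_succ', Equiv.Perm.mul_apply, Equiv.Perm.mul_apply, ih, Z.A_rot]

lemma A_pow_F_pow (i : ℕ) (x : V) :
    (Z.A ^ i) ((Z.F ^ i) x) = Z.rot (Z.q * Z.sh x * ∑ j ∈ Finset.range i, Z.q ^ j) x := by
  induction i with
  | zero => simp [Z.rot_zero]
  | succ i ih =>
    rw [pow_succ, pow_succ', Equiv.Perm.mul_apply, Equiv.Perm.mul_apply, A_F, A_pow_rot, ih,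
      Z.sh_F_pow, ← Z.rot_add, Finset.sum_range_succ]
    congr 2; ring

lemma A_pow_m (x : V) : (Z.A ^ m) x = Z.rot (Z.c x) x := by
  have h := Z.A_pow_F_pow m x
  rw [Z.F_pow_m, Z.A_pow_rot] at h
  apply (Z.rot Z.t).injective
  rw [h, ← Z.rot_add]
  congr 2
  change Z.q * Z.sh x * Z.R = _
  unfold c
  linear_combination Z.sh x * Z.q_mul_R x

lemma A_pow_mul (k : ℕ) (x : V) : (Z.A ^ (m * k)) x = Z.rot (k * Z.c x) x := by
  induction k with
  | zero => simp [Z.rot_zero]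
  | succ k ih =>
    rw [mul_add, pow_add, Equiv.Perm.mul_apply, mul_one, Z.A_pow_m, Z.A_pow_rot, ih, ← Z.rot_add]
    congr 2; push_cast; ring

lemma c_rot (a : ZMod n) (x : V) : Z.c (Z.rot a x) = Z.c x := by
  unfold c; rw [Z.sh_rot]

lemma sameCycle_S_A (h : ∀ x, ∃ j : ℕ, (Z.q - 1) * Z.sh x = j * Z.c x) (x : V) :
    Z.A.SameCycle (Z.S (Z.A x)) (Z.S x) := by
  obtain ⟨y, rfl⟩ := Z.F.surjective x
  obtain ⟨j, hj⟩ := h y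
  suffices (Z.A ^ (m * j)) (Z.S (Z.A (Z.F y))) = Z.A (Z.S (Z.F y)) by
    rw [← Equiv.Perm.sameCycle_apply_right, ← this]
    exact ⟨(m * j : ℕ), by rw [zpow_natCast]⟩
  rw [A_F, S_rot, Z.S_eq y, ← Z.rot_add, A_pow_mul, c_rot, ← hj, ← Z.rot_add, Z.S_eq (Z.F y), A_rot,
    A_F, Z.sh_F, ← Z.rot_add]
  congr 2; ring

lemma not_sameCycle [Finite V] (h : ∀ x, ∀ j : ZMod n, 2 * Z.sh x ≠ j * Z.c x) (x : V) :
    ¬ Z.A.SameCycle x (Z.S (Z.S x)) := by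
  intro hs
  obtain ⟨i, hi⟩ := hs.exists_nat_pow_eq
  have hl := Z.lev_A_pow i x
  rw [hi, Z.lev_S, Z.lev_S, add_eq_left] at hl
  obtain ⟨k, rfl⟩ := (ZMod.natCast_eq_zero_iff i m).1 hl
  rw [A_pow_mul, Z.S_eq x, Z.S_rot, Z.S_eq x, ← Z.rot_add] at hi
  exact h x k (by linear_combination -Z.rot_inj hi)

end SpiralSystem

/-! ### Alternating cycles -/

section Alternating

variable {X : SimpleGraph V} {D : V → V → Prop} {F S : Equiv.Perm V}

lemma mem_edges_iff_getVert {u v : V} (p : X.Walk u v) (e : Sym2 V) :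
    e ∈ p.edges ↔ ∃ i < p.length, e = s(p.getVert i, p.getVert (i + 1)) := by
  induction e with
  | h x y => simp only [p.mk_mem_edges_iff_exists, eq_comm]

/-- Along an alternating cycle whose first arc is `(v, S v)` the arcs given by `S` and by `F`
alternate. -/
lemma IsAlternatingCycle.getVert_eq (hD : ∀ x y, D x y ↔ y = F x ∨ y = S x) {v : V}
    {p : X.Walk v v} (hp : IsAlternatingCycle D p) (h1 : p.getVert 1 = S v) (i : ℕ)
    (hi : 2 * i < p.length) :
    p.getVert (2 * i) = ((F⁻¹ * S) ^ i) v ∧ p.getVert (2 * i + 1) = S (((F⁻¹ * S) ^ i) v) := by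
  obtain ⟨hc, he, ha⟩ := hp
  have hinj := hc.getVert_injOn'
  induction i with
  | zero => simpa using h1
  | succ i ih =>
    obtain ⟨i1, i2⟩ := ih (by omega)
    have hlt : 2 * i + 3 < p.length := by
      rcases he with ⟨r, hr⟩
      omega
    have a1 := (ha (2 * i + 1) (by omega)).2 ⟨i, rfl⟩
    have a2 := (ha (2 * i + 2) (by omega)).1 ⟨i + 1, by ring⟩
    rw [i2, hD] at a1
    have e1 : F (p.getVert (2 * i + 1 + 1)) = S (((F⁻¹ * S) ^ i) v) := by
      rcases a1 with a1 | a1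
      · exact a1.symm
      · have := S.injective a1
        rw [← i1] at this
        have := hinj (by simp; omega) (by simp; omega) this
        omega
    have e2 : p.getVert (2 * (i + 1)) = ((F⁻¹ * S) ^ (i + 1)) v := by
      apply F.injective
      rw [pow_succ', Equiv.Perm.mul_apply, Equiv.Perm.mul_apply, ← e1]
      exact (F.apply_symm_apply _).symm
    refine ⟨e2, ?_⟩
    rw [← e2]
    rcases (hD _ _).1 a2 with a2 | a2
    · rw [e1, ← i2] at a2
      have := hinj (by simp; omega) (by simp; omega) a2
      omega
    · exact a2

lemma IsAlternatingCycle.support_edges_length_of_getVert_one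
    (hD : ∀ x y, D x y ↔ y = F x ∨ y = S x) {v : V} {p : X.Walk v v} (hp : IsAlternatingCycle D p) (h1 : p.getVert 1 = S v) :
    (∀ x, x ∈ p.support ↔ ∃ y, (F⁻¹ * S).SameCycle v y ∧ (x = y ∨ x = S y)) ∧
    (∀ e, e ∈ p.edges ↔ ∃ y, (F⁻¹ * S).SameCycle v y ∧ (e = s(y, F y) ∨ e = s(y, S y))) ∧
    p.length = 2 * {y | (F⁻¹ * S).SameCycle v y}.ncard := by
  have hgv := hp.getVert_eq hD h1
  obtain ⟨hc, he, ha⟩ := hp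
  have hinj := hc.getVert_injOn'
  have h3 := hc.three_le_length
  obtain ⟨L, hL⟩ := he
  set B := F⁻¹ * S with hB
  have hFB : ∀ x, F (B x) = S x := fun x => F.apply_symm_apply _
  have hclose : (B ^ L) v = v := by
    have a := (ha (2 * (L - 1) + 1) (by omega)).2 ⟨L - 1, rfl⟩
    have e0 : p.getVert (2 * (L - 1) + 1 + 1) = v := by
      rw [show 2 * (L - 1) + 1 + 1 = p.length by omega, p.getVert_length]
    rw [e0, (hgv (L - 1) (by omega)).2, hD] at a
    rcases a with a | a
    · apply F.injective
      rw [← a, ← hFB, ← Equiv.Perm.mul_apply B, ← pow_succ', show L - 1 + 1 = L by omega]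
    · have h := S.injective a
      rw [← (hgv (L - 1) (by omega)).1] at h
      replace h := h.trans p.getVert_zero.symm
      have := hinj (by simp; omega) (by simp) h
      omega
  have hsame : ∀ y, B.SameCycle v y ↔ ∃ i < L, (B ^ i) v = y := by
    intro y
    constructor
    · rintro ⟨j, rfl⟩
      have hL0 : (0 : ℤ) < L := by omega
      refine ⟨(j % L).toNat, by have := Int.emod_lt_of_pos j hL0; omega, ?_⟩
      have hLz : ∀ k : ℤ, ((B ^ L) ^ k) v = v := fun k =>
        Function.IsFixedPt.perm_zpow hclose k
      conv_rhs => rw [← Int.emod_add_mul_ediv j L, zpow_add, zpow_mul, zpow_natCast,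
        Equiv.Perm.mul_apply, hLz]
      rw [← zpow_natCast, Int.toNat_of_nonneg (Int.emod_nonneg j hL0.ne')]
    · rintro ⟨i, -, rfl⟩
      exact ⟨i, by rw [zpow_natCast]⟩
  refine ⟨fun x => ?_, fun e => ?_, ?_⟩
  · rw [SimpleGraph.Walk.mem_support_iff_exists_getVert]
    constructor
    · rintro ⟨i, rfl, hi⟩
      rcases hi.eq_or_lt with rfl | hi
      · exact ⟨v, Equiv.Perm.SameCycle.rfl, Or.inl p.getVert_length⟩
      · obtain ⟨k, rfl | rfl⟩ := Nat.even_or_odd' i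
        · exact ⟨_, (hsame _).2 ⟨k, by omega, rfl⟩, Or.inl (hgv k hi).1⟩
        · exact ⟨_, (hsame _).2 ⟨k, by omega, rfl⟩, Or.inr (hgv k (by omega)).2⟩
    · rintro ⟨y, hy, hx⟩
      obtain ⟨i, hi, rfl⟩ := (hsame y).1 hy
      rcases hx with rfl | rfl
      · exact ⟨2 * i, (hgv i (by omega)).1, by omega⟩
      · exact ⟨2 * i + 1, (hgv i (by omega)).2, by omega⟩
  · rw [mem_edges_iff_getVert]
    have hnext : ∀ k < L, p.getVert (2 * k + 1 + 1) = (B ^ (k + 1)) v := by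
      intro k hk
      rcases (show k + 1 ≤ L from hk).eq_or_lt with h | h
      · rw [show 2 * k + 1 + 1 = p.length by omega, p.getVert_length, h, hclose]
      · exact (hgv (k + 1) (by omega)).1
    have hS : ∀ k, S ((B ^ k) v) = F ((B ^ (k + 1)) v) := by
      intro k
      rw [pow_succ', Equiv.Perm.mul_apply, hFB]
    constructor
    · rintro ⟨i, hi, rfl⟩
      obtain ⟨k, rfl | rfl⟩ := Nat.even_or_odd' i
      · refine ⟨_, (hsame _).2 ⟨k, by omega, rfl⟩, Or.inr ?_⟩
        rw [(hgv k hi).1, (hgv k hi).2]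
      · refine ⟨(B ^ (k + 1)) v, ⟨(k + 1 : ℕ), by rw [zpow_natCast]⟩, Or.inl ?_⟩
        rw [(hgv k (by omega)).2, hnext k (by omega), hS, Sym2.eq_swap]
    · rintro ⟨y, hy, hx⟩
      rcases hx with rfl | rfl
      · rw [← Equiv.Perm.sameCycle_symm_apply_right] at hy
        obtain ⟨i, hi, hiy⟩ := (hsame _).1 hy
        refine ⟨2 * i + 1, by omega, ?_⟩
        have hy' : y = (B ^ (i + 1)) v := by
          rw [pow_succ', Equiv.Perm.mul_apply, hiy]; simp
        rw [(hgv i (by omega)).2, hnext i hi, hS, hy', Sym2.eq_swap]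
      · obtain ⟨i, hi, rfl⟩ := (hsame y).1 hy
        refine ⟨2 * i, by omega, ?_⟩
        rw [(hgv i (by omega)).1, (hgv i (by omega)).2]
  · have : {y | B.SameCycle v y} = (fun i => (B ^ i) v) '' Set.Iio L := by
      ext y
      simp [hsame]
    rw [this, Set.InjOn.ncard_image, Set.ncard_eq_toFinset_card']
    · simp; omega
    · intro i hi j hj hij
      simp only [Set.mem_Iio] at hi hj
      simp only at hij
      rw [← (hgv i (by omega)).1, ← (hgv j (by omega)).1] at hij
      have := hinj (by simp; omega) (by simp; omega) hij
      omega

/-- The tails of an alternating cycle form a cycle `T` of `F⁻¹ * S`, and its heads form `S '' T`. -/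
lemma IsAlternatingCycle.support_edges_length (hD : ∀ x y, D x y ↔ y = F x ∨ y = S x) {v : V}
    {p : X.Walk v v} (hp : IsAlternatingCycle D p) :
    (∀ x, x ∈ p.support ↔ ∃ y, (F⁻¹ * S).SameCycle v y ∧ (x = y ∨ x = S y)) ∧
    (∀ e, e ∈ p.edges ↔ ∃ y, (F⁻¹ * S).SameCycle v y ∧ (e = s(y, F y) ∨ e = s(y, S y))) ∧
    p.length = 2 * {y | (F⁻¹ * S).SameCycle v y}.ncard := by
  have h3 := hp.1.three_le_length
  have h01 := (hp.2.2 0 (by omega)).1 ⟨0, rfl⟩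
  rw [p.getVert_zero, zero_add, hD] at h01
  rcases h01 with h01 | h01
  swap
  · exact hp.support_edges_length_of_getVert_one hD h01
  have hinv : S⁻¹ * F = (F⁻¹ * S)⁻¹ := by group
  have hFB : ∀ x, S x = F ((F⁻¹ * S) x) := fun x => (F.apply_symm_apply _).symm
  obtain ⟨d1, d2, d3⟩ := hp.support_edges_length_of_getVert_one (F := S) (S := F)
    (fun x y => (hD x y).trans or_comm) h01
  simp only [hinv, Equiv.Perm.sameCycle_inv] at d1 d2 d3
  refine ⟨fun x => (d1 x).trans ?_, fun e => (d2 e).trans ?_, d3⟩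
  · constructor
    · rintro ⟨y, hy, rfl | rfl⟩
      · exact ⟨x, hy, Or.inl rfl⟩
      · refine ⟨(F⁻¹ * S).symm y, by rwa [Equiv.Perm.sameCycle_symm_apply_right], Or.inr ?_⟩
        rw [hFB]; simp
    · rintro ⟨y, hy, rfl | rfl⟩
      · exact ⟨x, hy, Or.inl rfl⟩
      · exact ⟨(F⁻¹ * S) y, by rwa [Equiv.Perm.sameCycle_apply_right], Or.inr (hFB y)⟩
  · exact exists_congr fun y => and_congr_right fun _ => or_comm

/-- If `S` permutes the cycles of `F⁻¹ * S`, then the tails of one of two adjacent alternating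
cycles are the heads of the other one. They have no further common vertex, because `S ^ 2` fixes no
cycle of `F⁻¹ * S`. -/
lemma IsAlternatingCycle.two_mul_ncard [Finite V] (hD : ∀ x y, D x y ↔ y = F x ∨ y = S x)
    (hS : ∀ x y, (F⁻¹ * S).SameCycle x y ↔ (F⁻¹ * S).SameCycle (S x) (S y))
    (hS2 : ∀ x, ¬ (F⁻¹ * S).SameCycle x (S (S x))) {v w : V} {p : X.Walk v v} {q : X.Walk w w}
    (hp : IsAlternatingCycle D p) (hq : IsAlternatingCycle D q) (hpq : AdjacentCycles p q) :
    2 * {x | x ∈ p.support ∧ x ∈ q.support}.ncard = p.length := by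
  obtain ⟨p1, p2, p3⟩ := hp.support_edges_length hD
  obtain ⟨q1, q2, q3⟩ := hq.support_edges_length hD
  obtain ⟨hne, x, hxp, hxq⟩ := hpq
  set B := F⁻¹ * S with hB
  have hvw : ¬ B.SameCycle v w := by
    intro h
    refine hne ?_
    ext e
    have : ∀ y, B.SameCycle v y ↔ B.SameCycle w y := fun y => ⟨h.symm.trans, h.trans⟩
    simp only [Set.mem_ofPred_eq, p2, q2, this]
  rw [p3]
  congr 1
  rw [p1] at hxp
  rw [q1] at hxq
  obtain ⟨y, hy, hxy⟩ := hxp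
  obtain ⟨z, hz, hxz⟩ := hxq
  rcases hxy with rfl | rfl <;> rcases hxz with rfl | h
  · exact absurd (hy.trans hz.symm) hvw
  · subst h
    congr 1
    ext u
    simp only [Set.mem_ofPred_eq, p1, q1]
    constructor
    · rintro ⟨⟨a, ha, hua⟩, ⟨b, hb, hub⟩⟩
      rcases hua with rfl | rfl
      · exact ha
      · rcases hub with rfl | hub
        · have h1 := (hS _ _).1 (hy.symm.trans ha)
          exact absurd ((hz.symm.trans hb).trans h1.symm) (hS2 z)
        · exact absurd ((S.injective hub ▸ ha).trans hb.symm) hvw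
    · intro hu
      refine ⟨⟨u, hu, Or.inl rfl⟩, S.symm u, hz.trans ((hS _ _).2 ?_), Or.inr (by simp)⟩
      simpa using hy.symm.trans hu
  · have hset : {u | u ∈ p.support ∧ u ∈ q.support} = S '' {u | B.SameCycle v u} := by
      ext u
      simp only [Set.mem_ofPred_eq, p1, q1, Set.mem_image]
      constructor
      · rintro ⟨⟨a, ha, hua⟩, ⟨b, hb, hub⟩⟩
        rcases hua with rfl | rfl
        · rcases hub with rfl | rfl
          · exact absurd (ha.trans hb.symm) hvw
          · have h1 := (hS _ _).1 (hz.symm.trans hb)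
            exact absurd ((hy.symm.trans ha).trans h1.symm) (hS2 y)
        · exact ⟨a, ha, rfl⟩
      · rintro ⟨a, ha, rfl⟩
        exact ⟨⟨a, ha, Or.inr rfl⟩, _, hz.trans ((hS _ _).1 (hy.symm.trans ha)), Or.inl rfl⟩
    rw [hset, Set.ncard_image_of_injective _ S.injective]
  · exact absurd ((S.injective h ▸ hy).trans hz.symm) hvw

/-- The criterion of `IsAlternatingCycle.two_mul_ncard` does not depend on which of the two opposite
orientations is used. -/
lemma isTightlyAttached_of_sameCycle [Finite V]
    (hX : ∀ a b, X.Adj a b → arcOrbital X a b = D ∨ arcOrbital X a b = fun x y => D y x)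
    (hD : ∀ x y, D x y ↔ y = F x ∨ y = S x)
    (hS : ∀ x, (F⁻¹ * S).SameCycle (S ((F⁻¹ * S) x)) (S x))
    (hS2 : ∀ x, ¬ (F⁻¹ * S).SameCycle x (S (S x))) : IsTightlyAttached X := by
  set B := F⁻¹ * S with hB
  have hS' : ∀ x y, B.SameCycle x y → B.SameCycle (S x) (S y) := by
    intro x y h
    obtain ⟨i, rfl⟩ := h.exists_nat_pow_eq
    clear h
    induction i with
    | zero => exact Equiv.Perm.SameCycle.rfl
    | succ i ih =>
      rw [pow_succ', Equiv.Perm.mul_apply]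
      exact ih.trans (hS _).symm
  have hpow : ∀ (k : ℕ) (x y : V), B.SameCycle x y → B.SameCycle ((S ^ k) x) ((S ^ k) y) := by
    intro k x y h
    induction k with
    | zero => exact h
    | succ k ih =>
      rw [pow_succ', Equiv.Perm.mul_apply, Equiv.Perm.mul_apply]
      exact hS' _ _ ih
  have hSi : ∀ x y, B.SameCycle x y ↔ B.SameCycle (S x) (S y) := by
    refine fun x y => ⟨hS' x y, fun h => ?_⟩
    have h1 := hpow (orderOf S - 1) _ _ h
    rw [← Equiv.Perm.mul_apply, ← Equiv.Perm.mul_apply, ← pow_succ,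
      Nat.sub_add_cancel (orderOf_pos S), pow_orderOf_eq_one] at h1
    exact h1
  intro a b hab v w p q hp hq hpq
  rcases hX a b hab with h | h <;> rw [h] at hp hq
  · exact hp.two_mul_ncard hD hSi hS2 hq hpq
  · have hB' : ∀ x y, (F⁻¹⁻¹ * S⁻¹).SameCycle x y ↔ B.SameCycle x y := by
      intro x y
      have : F⁻¹⁻¹ * S⁻¹ = (S * B * S⁻¹)⁻¹ := by rw [hB]; group
      rw [this, Equiv.Perm.sameCycle_inv, Equiv.Perm.sameCycle_conj, hSi]
      simp
    refine hp.two_mul_ncard (F := F⁻¹) (S := S⁻¹) ?_ ?_ ?_ hq hpq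
    · intro x y
      rw [hD, Equiv.Perm.eq_inv_iff_eq, Equiv.Perm.eq_inv_iff_eq, eq_comm, eq_comm (a := x)]
    · intro x y
      rw [hB', hB', hSi (S⁻¹ x)]
      simp
    · intro x hx
      rw [hB'] at hx
      have := hS2 (S⁻¹ (S⁻¹ x))
      exact this (by simpa using hx.symm)

end Alternating

/-! ### The orientation -/

/-- `D` is an orientation of `X` whose arcs form an orbit of the automorphism group. -/
structure IsArcOrbit (X : SimpleGraph V) (D : V → V → Prop) : Prop where
  adj_iff : ∀ x y, X.Adj x y ↔ D x y ∨ D y x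
  asymm : ∀ {x y}, D x y → ¬ D y x
  map : ∀ (g : X ≃g X) {x y}, D x y → D (g x) (g y)
  trans : ∀ {x y x' y'}, D x y → D x' y' → ∃ g : X ≃g X, g x = x' ∧ g y = y'

lemma IsHalfArcTransitive.isArcOrbit {X : SimpleGraph V} (h : IsHalfArcTransitive X) {a b : V}
    (hab : X.Adj a b) : IsArcOrbit X (arcOrbital X a b) := by
  obtain ⟨-, hE, hA⟩ := h
  have hmap : ∀ (g : X ≃g X) {x y}, arcOrbital X a b x y → arcOrbital X a b (g x) (g y) := by
    rintro g x y ⟨k, rfl, rfl⟩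
    exact ⟨g * k, rfl, rfl⟩
  have htrans : ∀ {x y x' y'}, arcOrbital X a b x y → arcOrbital X a b x' y' →
      ∃ g : X ≃g X, g x = x' ∧ g y = y' := by
    rintro x y x' y' ⟨k, rfl, rfl⟩ ⟨l, rfl, rfl⟩
    exact ⟨l * k⁻¹, by simp [RelIso.mul_apply], by simp [RelIso.mul_apply]⟩
  have hadj : ∀ x y, X.Adj x y ↔ arcOrbital X a b x y ∨ arcOrbital X a b y x := by
    intro x y
    constructor
    · intro hxy
      obtain ⟨g, hg⟩ := hE s(a, b) hab s(x, y) hxy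
      rw [Sym2.map_mk, Sym2.eq_iff] at hg
      rcases hg with ⟨h1, h2⟩ | ⟨h1, h2⟩
      · exact Or.inl ⟨g, h1, h2⟩
      · exact Or.inr ⟨g, h1, h2⟩
    · rintro (⟨g, rfl, rfl⟩ | ⟨g, rfl, rfl⟩)
      · exact g.map_rel_iff.2 hab
      · exact (g.map_rel_iff.2 hab).symm
  refine ⟨hadj, ?_, hmap, htrans⟩
  intro x y hxy hyx
  obtain ⟨k, hk1, hk2⟩ := htrans hxy hyx
  have hall : ∀ u v, X.Adj u v → arcOrbital X a b u v := by
    intro u v huv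
    refine ((hadj u v).1 huv).elim id fun hvu => ?_
    obtain ⟨g, rfl, rfl⟩ := htrans hxy hvu
    exact hmap g hyx
  exact hA fun u v u' v' huv huv' => htrans (hall u v huv) (hall u' v' huv')

lemma IsArcOrbit.arcOrbital_eq {X : SimpleGraph V} {D : V → V → Prop} (hD : IsArcOrbit X D)
    {a b : V} (hab : X.Adj a b) :
    arcOrbital X a b = D ∨ arcOrbital X a b = fun x y => D y x := by
  have key : ∀ {x y}, D x y → ∀ u v, (∃ g : X ≃g X, g x = u ∧ g y = v) ↔ D u v := by
    intro x y hxy u v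
    constructor
    · rintro ⟨g, rfl, rfl⟩
      exact hD.map g hxy
    · exact hD.trans hxy
  rcases (hD.adj_iff a b).1 hab with h | h
  · left
    ext x y
    exact key h x y
  · right
    ext x y
    exact (exists_congr fun g => and_comm).trans (key h y x)

/-! ### Levels -/

/-- `lev` numbers the orbits of `ρ` modulo `m` in the order in which `σ` permutes them, and `ρ` acts
on each of them as a cycle of length `n`. -/
structure IsLeveling {X : SimpleGraph V} {m : ℕ} (n : ℕ) (ρ σ : X ≃g X) (lev : V → ZMod m) :
    Prop where
  lev_eq_iff : ∀ x y, lev x = lev y ↔ ∃ k : ℤ, (ρ ^ k) x = y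
  lev_σ : ∀ x, lev (σ x) = lev x + 1
  zpow_eq_iff : ∀ (x : V) (k l : ℤ), (ρ ^ k) x = (ρ ^ l) x ↔ (k : ZMod n) = l

lemma mem_orbit_zpowers {X : SimpleGraph V} (ρ : X ≃g X) (x y : V) :
    y ∈ MulAction.orbit (Subgroup.zpowers ρ) x ↔ ∃ k : ℤ, (ρ ^ k) x = y := by
  constructor
  · rintro ⟨⟨_, k, rfl⟩, rfl⟩
    exact ⟨k, rfl⟩
  · rintro ⟨k, rfl⟩
    exact ⟨⟨ρ ^ k, k, rfl⟩, rfl⟩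

lemma zpow_smul_eq_zpow_smul_iff {G α : Type*} [Group G] [MulAction G α] [Finite α] (g : G) (x : α)
    (i j : ℤ) :
    g ^ i • x = g ^ j • x ↔
      (i : ZMod (MulAction.orbit (Subgroup.zpowers g) x).ncard) = j := by
  have := Fintype.ofFinite (MulAction.orbit (Subgroup.zpowers g) x)
  refine Iff.trans ?_ eq_comm
  rw [ZMod.intCast_eq_intCast_iff_dvd_sub, ← Nat.card_coe_set_eq,
    Nat.card_eq_fintype_card, ← MulAction.minimalPeriod_eq_card,
    ← MulAction.zpow_smul_eq_iff_minimalPeriod_dvd, sub_eq_neg_add, zpow_add, zpow_neg, mul_smul,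
    inv_smul_eq_iff]

lemma IsWeakMetacirculantRel.exists_isLeveling [Finite V] {X : SimpleGraph V} {m n : ℕ}
    {ρ σ : X ≃g X} (h : IsWeakMetacirculantRel X m n ρ σ) (x₀ : V) :
    ∃ lev : V → ZMod m, IsLeveling n ρ σ lev := by
  obtain ⟨-, -, ⟨hm, hn⟩, -, hσ, hcyc⟩ := h
  set O : V → Set V := fun x => MulAction.orbit (Subgroup.zpowers ρ) x with hO
  have hmem : ∀ x, O x ∈ orbits ρ := fun x => ⟨x, rfl⟩
  have himg : ∀ x, σ • O x = O (σ x) := by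
    intro x
    obtain ⟨y, hy⟩ := hσ _ (hmem x)
    have h1 : σ x ∈ O y := by
      change _ ∈ (fun v => MulAction.orbit (Subgroup.zpowers ρ) v) y
      rw [hy]
      exact ⟨x, MulAction.mem_orbit_self x, rfl⟩
    have h2 : O (σ x) = O y := MulAction.orbit_eq_iff.2 h1
    rw [h2]
    exact hy.symm
  have himgk : ∀ (k : ℕ) x, σ ^ k • O x = O ((σ ^ k) x) := by
    intro k x
    induction k with
    | zero => simp
    | succ k ih => rw [pow_succ', mul_smul, ih, himg]; rfl
  have horb : MulAction.orbit (Subgroup.zpowers σ) (O x₀) = orbits ρ := by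
    ext P
    constructor
    · rintro ⟨⟨_, k, rfl⟩, rfl⟩
      have : Finite (X ≃g X) := DFunLike.finite _
      obtain ⟨j, hj⟩ := (mem_powers_iff_mem_zpowers (x := σ)).2 ⟨k, rfl⟩
      change σ ^ k • O x₀ ∈ _
      change σ ^ j = σ ^ k at hj
      rw [← hj, himgk]
      exact hmem _
    · intro hP
      obtain ⟨k, hk⟩ := hcyc _ (hmem x₀) _ hP
      exact ⟨⟨σ ^ k, k, by simp⟩, hk⟩
  choose k hk using fun x => hcyc _ (hmem x₀) _ (hmem x)
  replace hk : ∀ x, σ ^ (k x : ℤ) • O x₀ = O x := fun x => by rw [zpow_natCast]; exact hk x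
  have hlev : ∀ (i j : ℤ), σ ^ i • O x₀ = σ ^ j • O x₀ ↔ (i : ZMod m) = j := by
    intro i j
    rw [zpow_smul_eq_zpow_smul_iff, horb, hm]
  refine ⟨fun x => (k x : ZMod m), ?_, ?_, ?_⟩
  · intro x y
    have := hlev (k x) (k y)
    rw [hk, hk] at this
    push_cast at this
    rw [← this, eq_comm, ← mem_orbit_zpowers]
    exact MulAction.orbit_eq_iff
  · intro x
    have := hlev (k (σ x)) (k x + 1)
    rw [hk, add_comm, zpow_add, mul_smul, hk, zpow_one, himg] at this
    push_cast at this
    rw [this.1 rfl, add_comm]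
  · intro x i j
    have := zpow_smul_eq_zpow_smul_iff ρ x i j
    rwa [hn _ (hmem x)] at this

/-! ### Neighbours in a weak metacirculant of Class II -/

section ClassII

variable {X : SimpleGraph V} {m n : ℕ} {ρ σ : X ≃g X} {lev : V → ZMod m} {D : V → V → Prop}

namespace IsLeveling

lemma lev_zpow_ρ (h : IsLeveling n ρ σ lev) (k : ℤ) (x : V) : lev ((ρ ^ k) x) = lev x :=
  ((h.lev_eq_iff _ _).2 ⟨k, rfl⟩).symm

lemma lev_pow_σ (h : IsLeveling n ρ σ lev) (k : ℕ) (x : V) : lev ((σ ^ k) x) = lev x + k := by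
  induction k with
  | zero => simp
  | succ k ih => rw [pow_succ', RelIso.mul_apply, h.lev_σ, ih]; push_cast; ring

lemma exists_shift [NeZero m] (h : IsLeveling n ρ σ lev) (x y : V) :
    ∃ g : X ≃g X, g x = y ∧ ∀ z, lev (g z) = lev z + (lev y - lev x) := by
  have h1 := h.lev_pow_σ (lev y - lev x).val
  simp only [ZMod.natCast_zmod_val] at h1
  obtain ⟨k, hk⟩ := (h.lev_eq_iff ((σ ^ (lev y - lev x).val) x) y).1 (by rw [h1]; ring)
  exact ⟨ρ ^ k * σ ^ (lev y - lev x).val, hk, fun z => by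
    rw [RelIso.mul_apply, h.lev_zpow_ρ, h1]⟩

lemma orbit_eq (h : IsLeveling n ρ σ lev) (x : V) :
    MulAction.orbit (Subgroup.zpowers ρ) x = {y | lev y = lev x} := by
  ext y
  rw [mem_orbit_zpowers, Set.mem_ofPred_eq, ← h.lev_eq_iff, eq_comm]

lemma exists_out [NeZero m] (h : IsLeveling n ρ σ lev) (hD : IsArcOrbit X D) {x y : V} {δ : ZMod m}
    (hxy : D x y) (hδ : lev y = lev x + δ) (x' : V) : ∃ y', D x' y' ∧ lev y' = lev x' + δ := by
  obtain ⟨g, rfl, hg⟩ := h.exists_shift x x'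
  exact ⟨g y, hD.map g hxy, by rw [hg, hg, hδ]; ring⟩

lemma exists_in [NeZero m] (h : IsLeveling n ρ σ lev) (hD : IsArcOrbit X D) {x y : V} {δ : ZMod m}
    (hxy : D x y) (hδ : lev y = lev x + δ) (y' : V) : ∃ x', D x' y' ∧ lev x' = lev y' - δ := by
  obtain ⟨g, rfl, hg⟩ := h.exists_shift y y'
  exact ⟨g x, hD.map g hxy, by rw [hg, hg, hδ]; ring⟩

lemma ncard_adj_same (h : IsLeveling n ρ σ lev) (hII : IsClassIIRel X m n ρ σ) (x : V) :
    {y | X.Adj x y ∧ lev y = lev x}.ncard = 2 := by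
  have := hII.2.1 _ ⟨x, rfl⟩ x (MulAction.mem_orbit_self x)
  simp only [h.orbit_eq] at this
  exact this

lemma ncard_adj_other (h : IsLeveling n ρ σ lev) (hII : IsClassIIRel X m n ρ σ) {x y : V}
    (hxy : X.Adj x y) (hne : lev y ≠ lev x) : {z | X.Adj x z ∧ lev z = lev y}.ncard = 1 := by
  have := (hII.2.2 _ ⟨x, rfl⟩).2 _ ⟨y, rfl⟩
  simp only [h.orbit_eq] at this
  refine this (fun he => hne ?_) ⟨x, rfl, y, rfl, hxy⟩ x rfl
  exact (Set.ext_iff.1 he y).1 rfl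

lemma ncard_levels [NeZero m] (h : IsLeveling n ρ σ lev) (hII : IsClassIIRel X m n ρ σ) (x : V) :
    {l | l ≠ lev x ∧ ∃ y, X.Adj x y ∧ lev y = l}.ncard = 2 := by
  rw [← (hII.2.2 _ ⟨x, rfl⟩).1]
  simp only [h.orbit_eq]
  have : {P | P ∈ orbits ρ ∧ P ≠ {y | lev y = lev x} ∧ Joined X {y | lev y = lev x} P} =
      (fun l => {y | lev y = l}) '' {l | l ≠ lev x ∧ ∃ y, X.Adj x y ∧ lev y = l} := by
    ext P
    constructor
    · rintro ⟨⟨z, rfl⟩, hne, u, hu, v, hv, huv⟩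
      simp only [h.orbit_eq] at hne hv ⊢
      refine ⟨lev z, ⟨fun he => hne (by rw [he]), ?_⟩, rfl⟩
      obtain ⟨g, rfl, hg⟩ := h.exists_shift u x
      refine ⟨g v, g.map_rel_iff.2 huv, ?_⟩
      rw [hg, show lev u = lev (g u) from hu, show lev v = lev z from hv]
      ring
    · rintro ⟨_, ⟨hne, y, hxy, rfl⟩, rfl⟩
      refine ⟨⟨y, h.orbit_eq y⟩, fun he => hne ?_, x, rfl, y, rfl, hxy⟩
      exact (Set.ext_iff.1 he y).1 rfl
  rw [this, Set.InjOn.ncard_image]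
  rintro _ ⟨-, y, -, rfl⟩ l - he
  exact (Set.ext_iff.1 he y).1 rfl

lemma existsUnique_out_same [NeZero m] (h : IsLeveling n ρ σ lev) (hII : IsClassIIRel X m n ρ σ)
    (hD : IsArcOrbit X D) [Nonempty V] :
    (∀ x, ∃! y, D x y ∧ lev y = lev x) ∧ ∀ y, ∃! x, D x y ∧ lev x = lev y := by
  obtain ⟨x, y, hxy, hl⟩ : ∃ x y, D x y ∧ lev y = lev x + 0 := by
    obtain ⟨x⟩ := ‹Nonempty V›
    obtain ⟨y, hxy, hl⟩ : {y | X.Adj x y ∧ lev y = lev x}.Nonempty :=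
      Set.nonempty_of_ncard_ne_zero (by rw [h.ncard_adj_same hII x]; norm_num)
    rcases (hD.adj_iff _ _).1 hxy with h1 | h1
    · exact ⟨x, y, h1, by rw [hl, add_zero]⟩
    · exact ⟨y, x, h1, by rw [hl, add_zero]⟩
  have hout := h.exists_out hD hxy hl
  have hin := h.exists_in hD hxy hl
  simp only [add_zero, sub_zero] at hout hin
  have key : ∀ z, ∃ a b, D z a ∧ D b z ∧ lev a = lev z ∧ lev b = lev z ∧
      ∀ c, X.Adj z c → lev c = lev z → c = a ∨ c = b := by
    intro z
    obtain ⟨a, ha, la⟩ := hout z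
    obtain ⟨b, hb, lb⟩ := hin z
    refine ⟨a, b, ha, hb, la, lb, fun c hc lc => ?_⟩
    have hab : a ≠ b := by rintro rfl; exact hD.asymm ha hb
    have : {a, b} = {y | X.Adj z y ∧ lev y = lev z} := by
      refine Set.eq_of_subset_of_ncard_le ?_ ?_ (Set.finite_of_ncard_ne_zero ?_)
      · rintro y (rfl | rfl)
        · exact ⟨(hD.adj_iff _ _).2 (Or.inl ha), la⟩
        · exact ⟨(hD.adj_iff _ _).2 (Or.inr hb), lb⟩
      · rw [h.ncard_adj_same hII, Set.ncard_pair hab]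
      · rw [h.ncard_adj_same hII]; norm_num
    exact (Set.ext_iff.1 this c).2 ⟨hc, lc⟩
  constructor
  · intro z
    obtain ⟨a, b, ha, hb, la, lb, hu⟩ := key z
    refine ⟨a, ⟨ha, la⟩, fun c ⟨hc, lc⟩ => ?_⟩
    refine (hu c ((hD.adj_iff _ _).2 (Or.inl hc)) lc).resolve_right ?_
    rintro rfl
    exact hD.asymm hc hb
  · intro z
    obtain ⟨a, b, ha, hb, la, lb, hu⟩ := key z
    refine ⟨b, ⟨hb, lb⟩, fun c ⟨hc, lc⟩ => ?_⟩
    refine (hu c ((hD.adj_iff _ _).2 (Or.inr hc)) lc).resolve_left ?_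
    rintro rfl
    exact hD.asymm hc ha

lemma existsUnique_out_next [NeZero m] (h : IsLeveling n ρ σ lev) (hII : IsClassIIRel X m n ρ σ)
    (hD : IsArcOrbit X D) [Nonempty V] :
    ∃ d : ZMod m, 2 * d ≠ 0 ∧ (∀ x, ∃! y, D x y ∧ lev y = lev x + d) ∧
      (∀ y, ∃! x, D x y ∧ lev x = lev y - d) ∧
      ∀ x y, D x y → lev y = lev x ∨ lev y = lev x + d := by
  obtain ⟨d, hd, x, y, hxy, hl⟩ : ∃ d, d ≠ 0 ∧ ∃ x y, D x y ∧ lev y = lev x + d := by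
    obtain ⟨x⟩ := ‹Nonempty V›
    obtain ⟨_, hne, y, hxy, rfl⟩ : {l | l ≠ lev x ∧ ∃ y, X.Adj x y ∧ lev y = l}.Nonempty :=
      Set.nonempty_of_ncard_ne_zero (by rw [h.ncard_levels hII x]; norm_num)
    rcases (hD.adj_iff _ _).1 hxy with h1 | h1
    · exact ⟨lev y - lev x, sub_ne_zero.2 hne, x, y, h1, by ring⟩
    · exact ⟨lev x - lev y, sub_ne_zero.2 hne.symm, y, x, h1, by ring⟩
  have hout := h.exists_out hD hxy hl
  have hin := h.exists_in hD hxy hl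
  have huniq : ∀ {x y z}, X.Adj x y → lev y ≠ lev x → X.Adj x z → lev z = lev y → z = y := by
    intro x y z h1 h2 h3 h4
    exact Set.ncard_le_one_iff (Set.finite_of_ncard_ne_zero (by
      rw [h.ncard_adj_other hII h1 h2]; norm_num)) |>.1 (h.ncard_adj_other hII h1 h2).le
      ⟨h3, h4⟩ ⟨h1, rfl⟩
  have hadj : ∀ {x y}, D x y → X.Adj x y := fun h => (hD.adj_iff _ _).2 (Or.inl h)
  have hne : ∀ x, ∀ y, lev y = lev x + d → lev y ≠ lev x := by
    intro x y h1 h2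
    rw [h1, add_eq_left] at h2
    exact hd h2
  have hne' : ∀ x, ∀ y, lev y = lev x - d → lev y ≠ lev x := by
    intro x y h1 h2
    rw [h1, sub_eq_self] at h2
    exact hd h2
  -- otherwise the out-neighbour and the in-neighbour in the other orbit would coincide
  have h2d : 2 * d ≠ 0 := by
    intro h2
    obtain ⟨a, ha, la⟩ := hout x
    obtain ⟨b, hb, lb⟩ := hin x
    have : b = a := huniq (hadj ha) (hne _ _ la) (hadj hb).symm
      (by rw [la, lb]; linear_combination -h2)
    exact hD.asymm ha (this ▸ hb)
  refine ⟨d, h2d, fun x => ?_, fun y => ?_, fun x y hxy => ?_⟩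
  · obtain ⟨a, ha, la⟩ := hout x
    exact ⟨a, ⟨ha, la⟩, fun c ⟨hc, lc⟩ => huniq (hadj ha) (hne _ _ la) (hadj hc) (lc.trans la.symm)⟩
  · obtain ⟨a, ha, la⟩ := hin y
    exact ⟨a, ⟨ha, la⟩, fun c ⟨hc, lc⟩ =>
      huniq (hadj ha).symm (hne' _ _ la) (hadj hc).symm (lc.trans la.symm)⟩
  · by_contra! hcon
    obtain ⟨a, ha, la⟩ := hout x
    obtain ⟨b, hb, lb⟩ := hin x
    have hset : {lev x + d, lev x - d} = {l | l ≠ lev x ∧ ∃ y, X.Adj x y ∧ lev y = l} := by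
      refine Set.eq_of_subset_of_ncard_le ?_ ?_ (Set.toFinite _)
      · rintro l (rfl | rfl)
        · exact ⟨la ▸ hne _ _ la, a, hadj ha, la⟩
        · exact ⟨lb ▸ hne' _ _ lb, b, (hadj hb).symm, lb⟩
      · rw [h.ncard_levels hII, Set.ncard_pair]
        intro h1
        exact h2d (by linear_combination h1)
    rcases (Set.ext_iff.1 hset (lev y)).2 ⟨hcon.1, y, hadj hxy, rfl⟩ with h1 | h1
    · exact hcon.2 h1
    · have : y = b := huniq (hadj hb).symm (hne' _ _ lb) (hadj hxy) (h1.trans lb.symm)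
      exact hD.asymm hxy (this ▸ hb)

end IsLeveling

end ClassII

/-! ### The spiral system of a weak metacirculant of Class II -/

lemma of_perm_apply [Finite V] {f : Equiv.Perm V} {P : V → Prop} (hf : ∀ x, P x → P (f x)) {x : V}
    (hx : P (f x)) : P x := by
  have hk : ∀ (k : ℕ) y, P y → P ((f ^ k) y) := by
    intro k y hy
    induction k with
    | zero => exact hy
    | succ k ih => rw [pow_succ', Equiv.Perm.mul_apply]; exact hf _ ih
  have := hk (orderOf f - 1) _ hx
  rwa [← Equiv.Perm.mul_apply, ← pow_succ, Nat.sub_add_cancel (orderOf_pos f),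
    pow_orderOf_eq_one] at this

/-- In a finite graph, the inverse of a permutation is one of its powers, so that it suffices to
follow arcs forwards. -/
lemma generated_of_connected [Finite V] {X : SimpleGraph V} (hX : X.Connected) {D : V → V → Prop}
    {F S : Equiv.Perm V} (hadj : ∀ x y, X.Adj x y ↔ D x y ∨ D y x)
    (hD : ∀ x y, D x y ↔ y = F x ∨ y = S x) (P : V → Prop) (x₀ : V) (h₀ : P x₀)
    (hF : ∀ x, P x → P (F x)) (hS : ∀ x, P x → P (S x)) (x : V) : P x := by
  obtain ⟨p⟩ := hX.preconnected x₀ x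
  induction p with
  | nil => exact h₀
  | @cons u v w h p ih =>
    apply ih
    rcases (hadj u v).1 h with h | h
    · rcases (hD _ _).1 h with rfl | rfl
      · exact hF _ h₀
      · exact hS _ h₀
    · rcases (hD _ _).1 h with rfl | rfl
      · exact of_perm_apply hF h₀
      · exact of_perm_apply hS h₀

section Build

variable {X : SimpleGraph V} {m n : ℕ} {ρ σ : X ≃g X} {lev : V → ZMod m} {D : V → V → Prop}

/-- The two out-neighbours of a vertex, the one at the same level and the one at the next, depend on
it bijectively. -/
lemma IsLeveling.exists_perms [Finite V] [Nonempty V] [NeZero m] (h : IsLeveling n ρ σ lev)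
    (hII : IsClassIIRel X m n ρ σ) (hD : IsArcOrbit X D) :
    ∃ (d : ZMod m) (F S : Equiv.Perm V), 2 * d ≠ 0 ∧ (∀ x, lev (F x) = lev x + d) ∧
      (∀ x, lev (S x) = lev x) ∧ ∀ x y, D x y ↔ y = F x ∨ y = S x := by
  obtain ⟨o1, i1⟩ := h.existsUnique_out_same hII hD
  obtain ⟨d, hd, o2, i2, hor⟩ := h.existsUnique_out_next hII hD
  choose S hS uS using o1
  choose F hF uF using o2
  have injS : Function.Injective S := fun x y hxy =>
    (i1 (S x)).unique ⟨(hS x).1, (hS x).2.symm⟩ (hxy ▸ ⟨(hS y).1, (hS y).2.symm⟩)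
  have injF : Function.Injective F := fun x y hxy =>
    (i2 (F x)).unique ⟨(hF x).1, by rw [(hF x).2]; ring⟩
      (hxy ▸ ⟨(hF y).1, by rw [(hF y).2]; ring⟩)
  refine ⟨d, Equiv.ofBijective F (Finite.injective_iff_bijective.1 injF),
    Equiv.ofBijective S (Finite.injective_iff_bijective.1 injS), hd, fun x => (hF x).2,
    fun x => (hS x).2, fun x y => ⟨fun hxy => ?_, ?_⟩⟩
  · rcases hor x y hxy with hl | hl
    · exact Or.inr (uS x y ⟨hxy, hl⟩)
    · exact Or.inl (uF x y ⟨hxy, hl⟩)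
  · rintro (rfl | rfl)
    · exact (hF x).1
    · exact (hS x).1

/-- An automorphism that shifts all levels by the same amount respects the two kinds of arcs. -/
lemma IsArcOrbit.commute_of_shift (hD : IsArcOrbit X D) {d : ZMod m} (hd : d ≠ 0)
    {F S : Equiv.Perm V} (hF : ∀ x, lev (F x) = lev x + d) (hS : ∀ x, lev (S x) = lev x)
    (hDFS : ∀ x y, D x y ↔ y = F x ∨ y = S x) {g : X ≃g X} {k : ZMod m}
    (hg : ∀ x, lev (g x) = lev x + k) (x : V) : g (F x) = F (g x) ∧ g (S x) = S (g x) := by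
  have hne : ∀ y, lev y + d ≠ lev y := fun y h => hd (by rwa [add_eq_left] at h)
  constructor
  · refine ((hDFS _ _).1 (hD.map g ((hDFS _ _).2 (Or.inl rfl)))).resolve_right fun he => ?_
    have := congrArg lev he
    rw [hg, hS, hF, hg] at this
    exact hd (by linear_combination this)
  · refine ((hDFS _ _).1 (hD.map g ((hDFS _ _).2 (Or.inr rfl)))).resolve_left fun he => ?_
    have := congrArg lev he
    rw [hg, hF, hS, hg] at this
    exact hd (by linear_combination -this)

lemma generated_isUnit {F S : Equiv.Perm V} {d : ZMod m} (hF : ∀ x, lev (F x) = lev x + d)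
    (hS : ∀ x, lev (S x) = lev x) (h : IsLeveling n ρ σ lev) [Nonempty V]
    (hgen : ∀ (P : V → Prop) (x₀ : V), P x₀ → (∀ x, P x → P (F x)) → (∀ x, P x → P (S x)) →
      ∀ x, P x) : IsUnit d := by
  obtain ⟨x₀⟩ := ‹Nonempty V›
  have := hgen (fun x => ∃ k : ZMod m, lev x = lev x₀ + k * d) x₀ ⟨0, by simp⟩
    (fun x ⟨k, hk⟩ => ⟨k + 1, by rw [hF, hk]; ring⟩) (fun x ⟨k, hk⟩ => ⟨k, by rw [hS, hk]⟩) (σ x₀)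
  obtain ⟨k, hk⟩ := this
  rw [h.lev_σ, add_right_inj] at hk
  exact IsUnit.of_mul_eq_one k (by rw [mul_comm]; exact hk.symm)

/-- The power of `ρ` whose exponent is the representative of `a` in `{0, …, n - 1}`. If `ρ` has order
`n`, then this does not depend on the representative. -/
def rotation (n : ℕ) (ρ : X ≃g X) (a : ZMod n) : Equiv.Perm V := (ρ ^ a.val).toEquiv

lemma rotation_apply (ρ : X ≃g X) (a : ZMod n) (x : V) : rotation n ρ a x = (ρ ^ a.val) x := rfl

lemma IsLeveling.zpow_eq_rotation [NeZero n] (h : IsLeveling n ρ σ lev) (k : ℤ) (x : V) :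
    (ρ ^ k) x = rotation n ρ k x := by
  rw [rotation_apply, ← zpow_natCast, h.zpow_eq_iff]
  simp

lemma IsLeveling.rotation_add [NeZero n] (h : IsLeveling n ρ σ lev) (a b : ZMod n) (x : V) :
    rotation n ρ (a + b) x = rotation n ρ a (rotation n ρ b x) := by
  have := h.zpow_eq_rotation (a.val + b.val : ℤ) x
  rw [zpow_add, RelIso.mul_apply] at this
  push_cast at this
  rw [ZMod.natCast_zmod_val, ZMod.natCast_zmod_val] at this
  rw [← this, rotation_apply, rotation_apply, zpow_natCast, zpow_natCast]

lemma IsLeveling.rotation_inj [NeZero n] (h : IsLeveling n ρ σ lev) {a b : ZMod n} {x : V}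
    (hab : rotation n ρ a x = rotation n ρ b x) : a = b := by
  rw [rotation_apply, rotation_apply, ← zpow_natCast, ← zpow_natCast, h.zpow_eq_iff] at hab
  simpa using hab

lemma IsLeveling.σ_rotation [NeZero n] (h : IsLeveling n ρ σ lev) {r : ℕ}
    (hr : σ * ρ * σ⁻¹ = ρ ^ r) (a : ZMod n) (x : V) :
    σ (rotation n ρ a x) = rotation n ρ (r * a) (σ x) := by
  have h1 : σ * ρ ^ a.val = ρ ^ (r * a.val) * σ := by
    rw [pow_mul, ← hr, conj_pow]; group
  have h2 := h.zpow_eq_rotation ((r * a.val : ℕ) : ℤ) (σ x)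
  rw [zpow_natCast] at h2
  push_cast at h2
  rw [ZMod.natCast_zmod_val] at h2
  rw [← h2, rotation_apply]
  exact DFunLike.congr_fun h1 x

lemma IsLeveling.σ_pow_rotation [NeZero n] (h : IsLeveling n ρ σ lev) {r : ℕ}
    (hr : σ * ρ * σ⁻¹ = ρ ^ r) (k : ℕ) (a : ZMod n) (x : V) :
    (σ ^ k) (rotation n ρ a x) = rotation n ρ (r ^ k * a) ((σ ^ k) x) := by
  induction k with
  | zero => simp
  | succ k ih =>
    rw [pow_succ', RelIso.mul_apply, ih, h.σ_rotation hr, RelIso.mul_apply]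
    congr 2; ring

/-- All the data of a spiral system, where `q` is the exponent by which `σ ^ d` acts on `ρ`, for the
number `d` of levels (with respect to `σ`) that `F` climbs. -/
lemma IsLeveling.exists_spiralSystem [Finite V] [Nonempty V] [NeZero m] [NeZero n]
    (h : IsLeveling n ρ σ lev) (hX : X.Connected) (hD : IsArcOrbit X D) {r : ℕ}
    (hr : σ * ρ * σ⁻¹ = ρ ^ r) {d : ZMod m} (hd : d ≠ 0)
    {F S : Equiv.Perm V} (hF : ∀ x, lev (F x) = lev x + d) (hS : ∀ x, lev (S x) = lev x)
    (hDFS : ∀ x y, D x y ↔ y = F x ∨ y = S x) :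
    IsUnit d ∧ ∃ Z : SpiralSystem V m n, Z.rot = rotation n ρ ∧ Z.F = F ∧ Z.S = S ∧
      Z.q = r ^ d.val := by
  have hgen := generated_of_connected hX hD.adj_iff hDFS
  have hdu := generated_isUnit hF hS h hgen
  refine ⟨hdu, ?_⟩
  have hcomm := fun {g : X ≃g X} {k : ZMod m} (hg : ∀ x, lev (g x) = lev x + k) =>
    hD.commute_of_shift hd hF hS hDFS hg
  have hlrot : ∀ a x, lev (rotation n ρ a x) = lev x := fun a x => by
    rw [rotation_apply, ← zpow_natCast, h.lev_zpow_ρ]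
  have crot : ∀ a x, rotation n ρ a (F x) = F (rotation n ρ a x) ∧
      rotation n ρ a (S x) = S (rotation n ρ a x) := fun a x =>
    hcomm (g := ρ ^ a.val) (k := 0) (fun y => by rw [add_zero]; exact hlrot a y) x
  have cσ : ∀ k x, (σ ^ k) (F x) = F ((σ ^ k) x) ∧ (σ ^ k) (S x) = S ((σ ^ k) x) := fun k x =>
    hcomm (h.lev_pow_σ k) x
  have hex : ∀ {x y}, lev x = lev y → ∃ a, rotation n ρ a x = y := by
    intro x y hxy
    obtain ⟨k, hk⟩ := (h.lev_eq_iff x y).1 hxy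
    exact ⟨k, by rw [← h.zpow_eq_rotation, hk]⟩
  choose sh hsh using fun x => hex (hS x).symm
  have sh_eq : ∀ {x a}, S x = rotation n ρ a x → sh x = a := fun {x a} hx =>
    h.rotation_inj ((hsh x).trans hx)
  have sh_rot : ∀ a x, sh (rotation n ρ a x) = sh x := by
    intro a x
    refine sh_eq ?_
    rw [← (crot a x).2, ← hsh x, ← h.rotation_add, ← h.rotation_add, add_comm]
  have sh_σ : ∀ (k : ℕ) x, sh ((σ ^ k) x) = r ^ k * sh x := by
    intro k x
    refine sh_eq ?_
    rw [← (cσ k x).2, ← h.σ_pow_rotation hr, hsh]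
  have sh_F : ∀ x, sh (F x) = r ^ d.val * sh x := by
    intro x
    obtain ⟨a, ha⟩ := hex (x := (σ ^ d.val) x) (y := F x) (by
      rw [h.lev_pow_σ, hF, ZMod.natCast_zmod_val])
    rw [← ha, sh_rot, sh_σ]
  have lFpow : ∀ (k : ℕ) x, lev ((F ^ k) x) = lev x + k * d := by
    intro k x
    induction k with
    | zero => simp
    | succ k ih => rw [pow_succ', Equiv.Perm.mul_apply, hF, ih]; push_cast; ring
  obtain ⟨x₀⟩ := ‹Nonempty V›
  obtain ⟨t, ht⟩ := hex (x := x₀) (y := (F ^ m) x₀) (by rw [lFpow]; simp)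
  have cFpow : ∀ (k : ℕ) {g : Equiv.Perm V}, (∀ x, g (F x) = F (g x)) → ∀ x,
      g ((F ^ k) x) = (F ^ k) (g x) := by
    intro k g hg x
    induction k with
    | zero => rfl
    | succ k ih => rw [pow_succ', Equiv.Perm.mul_apply, hg, ih, Equiv.Perm.mul_apply]
  have hFm : ∀ x, (F ^ m) x = rotation n ρ t x := by
    refine hgen _ x₀ ht.symm ?_ ?_
    · intro x hx
      rw [(crot t x).1, ← hx, cFpow m (g := F) fun _ => rfl]
    · intro x hx
      rw [← hsh x, ← cFpow m fun y => (crot _ y).1, hx, ← h.rotation_add, ← h.rotation_add,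
        add_comm]
  have hrt : ∀ k : ℕ, (r : ZMod n) ^ k * t = t := by
    intro k
    apply h.rotation_inj (x := (σ ^ k) x₀)
    rw [← hFm, ← h.σ_pow_rotation hr, ← hFm]
    exact cFpow m (g := (σ ^ k).toEquiv) (fun y => (cσ k y).1) x₀
  exact ⟨{
    rot := rotation n ρ
    F := F
    S := S
    sh := sh
    lev := fun x => d⁻¹ * lev x
    q := r ^ d.val
    t := t
    rot_zero := fun x => by simp [rotation_apply]
    rot_add := h.rotation_add
    rot_inj := h.rotation_inj
    F_rot := fun a x => ((crot a x).1).symm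
    S_eq := fun x => (hsh x).symm
    sh_rot := sh_rot
    sh_F := sh_F
    lev_rot := fun a x => by rw [hlrot]
    lev_F := fun x => by rw [hF, mul_add, ZMod.inv_mul_of_unit d hdu]
    exists_rot := fun {x y} hxy => hex (by
      have := congrArg (d * ·) hxy
      simpa only [← mul_assoc, ZMod.mul_inv_of_unit d hdu, one_mul] using this)
    F_pow_m := hFm
    q_mul_t := hrt _
    generated := hgen }, rfl, rfl, rfl, rfl⟩

end Build

/-! ### Correcting `σ` by a rotation -/

section Correct

variable {X : SimpleGraph V} {m n : ℕ} {ρ σ : X ≃g X} {lev : V → ZMod m} {D : V → V → Prop}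

lemma IsWeakMetacirculantRel.pow_mul (h : IsWeakMetacirculantRel X m n ρ σ) (k : ℕ) :
    IsWeakMetacirculantRel X m n ρ (ρ ^ k * σ) := by
  obtain ⟨hm, hn, hsemi, ⟨r, hrn, hr⟩, hσ, hcyc⟩ := h
  have hρ : ∀ O ∈ orbits ρ, ρ ^ k • O = O := by
    rintro _ ⟨x, rfl⟩
    exact MulAction.smul_orbit (⟨ρ ^ k, k, by simp⟩ : Subgroup.zpowers ρ) x
  have himg : ∀ O ∈ orbits ρ, (ρ ^ k * σ) • O = σ • O := by
    intro O hO
    rw [mul_smul]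
    exact hρ _ (hσ O hO)
  have hmem : ∀ (j : ℕ), ∀ O ∈ orbits ρ, σ ^ j • O ∈ orbits ρ := by
    intro j O hO
    induction j with
    | zero => simpa using hO
    | succ j ih => rw [pow_succ', mul_smul]; exact hσ _ ih
  have hpow : ∀ (j : ℕ), ∀ O ∈ orbits ρ, (ρ ^ k * σ) ^ j • O = σ ^ j • O := by
    intro j O hO
    induction j with
    | zero => simp
    | succ j ih => rw [pow_succ', mul_smul, ih, himg _ (hmem j O hO), pow_succ', mul_smul]
  refine ⟨hm, hn, hsemi, ⟨r, hrn, ?_⟩, fun O hO => ?_, fun O hO P hP => ?_⟩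
  · rw [show ρ ^ k * σ * ρ * (ρ ^ k * σ)⁻¹ = ρ ^ k * (σ * ρ * σ⁻¹) * (ρ ^ k)⁻¹ by group, hr]
    group
  · change (ρ ^ k * σ) • O ∈ orbits ρ
    rw [himg O hO]
    exact hσ O hO
  · obtain ⟨j, hj⟩ := hcyc O hO P hP
    exact ⟨j, (hpow j O hO).trans hj⟩

lemma lev_pow_of_shift {g : X ≃g X} {k : ZMod m} (hg : ∀ x, lev (g x) = lev x + k) (j : ℕ) (x : V) :
    lev ((g ^ j) x) = lev x + j * k := by
  induction j with
  | zero => simp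
  | succ j ih => rw [pow_succ', RelIso.mul_apply, hg, ih]; push_cast; ring

/-- For a solution `i` of `i * R + t = 0`, the product of `σ ^ d` and a rotation that carries `x₀` to
`rot i (F x₀)` is an automorphism `T` with `T ^ m = 1`; a power of `T` climbs one level. -/
lemma IsLeveling.exists_pow_mul [NeZero m] [NeZero n] (h : IsLeveling n ρ σ lev)
    (hD : IsArcOrbit X D) {r : ℕ} (hr : σ * ρ * σ⁻¹ = ρ ^ r) {d : ZMod m} (hd : d ≠ 0)
    (hdu : IsUnit d) (Z : SpiralSystem V m n) (hF : ∀ x, lev (Z.F x) = lev x + d)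
    (hS : ∀ x, lev (Z.S x) = lev x) (hDFS : ∀ x y, D x y ↔ y = Z.F x ∨ y = Z.S x)
    (hrot : Z.rot = rotation n ρ) (hq : Z.q = r ^ d.val) {i : ZMod n} (hi : i * Z.R + Z.t = 0)
    (x₀ : V) : ∃ k : ℕ, (ρ ^ k * σ) ^ m = 1 := by
  have hcomm := fun {g : X ≃g X} {k : ZMod m} (hg : ∀ x, lev (g x) = lev x + k) =>
    hD.commute_of_shift hd hF hS hDFS hg
  have hext : ∀ {g g' : X ≃g X} {k : ZMod m}, (∀ x, lev (g x) = lev x + k) →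
      (∀ x, lev (g' x) = lev x + k) → g x₀ = g' x₀ → g = g' := by
    intro g g' k hg hg' h0
    ext x
    refine Z.generated (fun x => g x = g' x) x₀ h0 ?_ ?_ x
    · intro x hx
      rw [(hcomm hg x).1, (hcomm hg' x).1, hx]
    · intro x hx
      rw [(hcomm hg x).2, (hcomm hg' x).2, hx]
  have hlρ : ∀ (k : ℕ) x, lev ((ρ ^ k) x) = lev x := fun k x => by
    rw [← zpow_natCast, h.lev_zpow_ρ]
  have hex : ∀ {x y}, lev x = lev y → ∃ a, Z.rot a x = y := by
    intro x y hxy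
    obtain ⟨k, hk⟩ := (h.lev_eq_iff x y).1 hxy
    exact ⟨k, by rw [hrot, ← h.zpow_eq_rotation, hk]⟩
  have hσd : ∀ x, lev ((σ ^ d.val) x) = lev x + d := fun x => by
    rw [h.lev_pow_σ, ZMod.natCast_zmod_val]
  obtain ⟨w, hw⟩ := hex (x := (σ ^ d.val) x₀) (y := Z.F x₀) (by rw [hσd, hF])
  obtain ⟨T, hT⟩ : ∃ T : X ≃g X, ∀ x, T x = Z.rot (i + w) ((σ ^ d.val) x) :=
    ⟨ρ ^ (i + w).val * σ ^ d.val, fun x => by rw [hrot]; rfl⟩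
  have hTl : ∀ x, lev (T x) = lev x + d := fun x => by
    rw [hT, hrot, rotation_apply, hlρ, hσd]
  have hσF : ∀ (j : ℕ) x, (σ ^ d.val) ((Z.F ^ j) x) = (Z.F ^ j) ((σ ^ d.val) x) := by
    intro j x
    induction j with
    | zero => rfl
    | succ j ih =>
      rw [pow_succ', Equiv.Perm.mul_apply, (hcomm hσd _).1, ih, Equiv.Perm.mul_apply]
  have hTj : ∀ j : ℕ, (T ^ j) x₀ =
      Z.rot (i * ∑ l ∈ Finset.range j, Z.q ^ l) ((Z.F ^ j) x₀) := by
    intro j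
    induction j with
    | zero => simp [Z.rot_zero]
    | succ j ih =>
      rw [pow_succ', RelIso.mul_apply, ih, hT, hrot, h.σ_pow_rotation hr, hσF, ← hrot, ← hq,
        Z.rot_add i w, ← Z.rot_add w, add_comm w, Z.rot_add _ w, ← Z.F_pow_rot j w, hw,
        ← Equiv.Perm.mul_apply (Z.F ^ j), ← pow_succ, ← Z.rot_add, geom_sum_succ]
      congr 2; ring
  have hTm : T ^ m = 1 := by
    refine hext (k := 0) (fun x => ?_) (fun x => by simp) ?_
    · rw [lev_pow_of_shift hTl]; simp
    · rw [hTj, Z.F_pow_m, ← Z.rot_add]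
      change Z.rot (i * Z.R + Z.t) x₀ = _
      rw [hi, Z.rot_zero]; rfl
  have hT'l : ∀ x, lev ((T ^ (d⁻¹).val) x) = lev x + 1 := fun x => by
    rw [lev_pow_of_shift hTl, ZMod.natCast_zmod_val, ZMod.inv_mul_of_unit d hdu]
  obtain ⟨k, hk⟩ := hex (x := σ x₀) (y := (T ^ (d⁻¹).val) x₀) (by rw [hT'l, h.lev_σ])
  refine ⟨k.val, ?_⟩
  have : ρ ^ k.val * σ = T ^ (d⁻¹).val := by
    refine hext (k := 1) (fun x => ?_) hT'l ?_
    · rw [RelIso.mul_apply, hlρ, h.lev_σ]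
    · rw [← hk, hrot]; rfl
  rw [this, ← pow_mul, mul_comm, pow_mul, hTm, one_pow]

/-- All arcs are in one orbit of the automorphism group, so some automorphism fixes `x` and carries one
of the two arcs that start at `x` to the other one. -/
lemma IsArcOrbit.exists_swap (hD : IsArcOrbit X D) (Z : SpiralSystem V m n)
    (hne : ∀ x, Z.F x ≠ Z.S x) (hDFS : ∀ x y, D x y ↔ y = Z.F x ∨ y = Z.S x) (x : V) :
    ∃ g : Equiv.Perm V, Z.IsAut g ∧ Z.SwapsAt g x := by
  obtain ⟨g, hgx, hgF⟩ := hD.trans ((hDFS x _).2 (Or.inl rfl)) ((hDFS x _).2 (Or.inr rfl))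
  have haut : Z.IsAut g.toEquiv := by
    intro y
    have h1 := (hDFS _ _).1 (hD.map g ((hDFS y _).2 (Or.inl rfl)))
    have h2 := (hDFS _ _).1 (hD.map g ((hDFS y _).2 (Or.inr rfl)))
    have h3 : g (Z.F y) ≠ g (Z.S y) := fun h => hne y (g.injective h)
    change (g _ = _ ∧ g _ = _) ∨ (g _ = _ ∧ g _ = _)
    rcases h1 with h1 | h1 <;> rcases h2 with h2 | h2
    · exact absurd (h1.trans h2.symm) h3
    · exact Or.inl ⟨h1, h2⟩
    · exact Or.inr ⟨h1, h2⟩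
    · exact absurd (h1.trans h2.symm) h3
  refine ⟨g.toEquiv, haut, (haut x).resolve_left fun h => hne x ?_⟩
  have h1 : g (Z.F x) = Z.F (g x) := h.1
  rw [hgx] at h1
  exact h1.symm.trans hgF

end Correct

end HalfArc

/-- A connected quartic half-arc-transitive weak `(m, n)`-metacirculant of Class II, relative to
`(ρ, σ)`, that is not tightly attached is an `(m, n)`-metacirculant, and some `σρᵏ` (apply `σ`
first, then `ρᵏ`) has order `m`, so that `(ρ, σρᵏ)` is a pair that shows this. -/
theorem proposition5p8 {V : Type*} [Fintype V] (X : SimpleGraph V) [DecidableRel X.Adj]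
    (m n : ℕ) (ρ σ : X ≃g X)
    (hconn : X.Connected) (hquartic : X.IsRegularOfDegree 4)
    (hhat : HalfArc.IsHalfArcTransitive X)
    (hII : HalfArc.IsClassIIRel X m n ρ σ)
    (hta : ¬ HalfArc.IsTightlyAttached X) :
    HalfArc.IsMetacirculant X m n ∧
      ∃ k : ℕ, orderOf (ρ ^ k * σ) = m ∧ HalfArc.IsMetacirculantRel X m n ρ (ρ ^ k * σ) := by
  have hne := hconn.nonempty
  obtain ⟨x₀⟩ := id hne
  have hweak := hII.1
  have : NeZero m := ⟨by have := hweak.1; omega⟩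
  have : NeZero n := ⟨by have := hweak.2.1; omega⟩
  suffices ∃ k : ℕ, (ρ ^ k * σ) ^ m = 1 by
    obtain ⟨k, hk⟩ := this
    have hrel : HalfArc.IsMetacirculantRel X m n ρ (ρ ^ k * σ) :=
      ⟨hweak.pow_mul k, x₀, by rw [hk]; rfl⟩
    refine ⟨⟨ρ, _, hrel⟩, k, Nat.dvd_antisymm (orderOf_dvd_of_pow_eq_one hk) ?_, hrel⟩
    -- `ρ ^ k * σ` permutes the `m` orbits of `ρ` in a single cycle
    obtain ⟨lev, hlev⟩ := hrel.1.exists_isLeveling x₀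
    have h := hlev.lev_pow_σ (orderOf (ρ ^ k * σ)) x₀
    rw [pow_orderOf_eq_one, RelIso.one_apply, left_eq_add] at h
    exact (ZMod.natCast_eq_zero_iff _ m).1 h
  obtain ⟨lev, hlev⟩ := hweak.exists_isLeveling x₀
  obtain ⟨y₀, hxy⟩ : ∃ y, X.Adj x₀ y := by
    rw [← X.degree_pos_iff_exists_adj, hquartic x₀]
    norm_num
  have hD := hhat.isArcOrbit hxy
  obtain ⟨d, F, S, hd2, hF, hS, hDFS⟩ := hlev.exists_perms hII hD
  have hd : d ≠ 0 := by rintro rfl; simp at hd2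
  obtain ⟨r, -, hr⟩ := hweak.2.2.2.1
  obtain ⟨hdu, Z, hrot, rfl, rfl, hq⟩ := hlev.exists_spiralSystem hconn hD hr hd hF hS hDFS
  have hm : 3 ≤ m := by
    by_contra hlt
    obtain rfl | rfl : m = 1 ∨ m = 2 := by have := hweak.1; omega
    · exact hd2 (Subsingleton.elim _ _)
    · exact hd2 (by rw [show (2 : ZMod 2) = 0 from rfl, zero_mul])
  have hFS : ∀ x, Z.F x ≠ Z.S x := by
    intro x h
    have := congrArg lev h
    rw [hF, hS, add_eq_left] at this
    exact hd this
  obtain ⟨g, hg, hgx⟩ := hD.exists_swap Z hFS hDFS x₀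
  rcases Z.dichotomy hm hg hgx with ⟨i, hi⟩ | hdiv
  · exact hlev.exists_pow_mul hD hr hd hdu Z hF hS hDFS hrot hq hi x₀
  · exact absurd (HalfArc.isTightlyAttached_of_sameCycle (fun a b hab => hD.arcOrbital_eq hab) hDFS
      (Z.sameCycle_S_A fun x => (hdiv x).1) (Z.not_sameCycle fun x => (hdiv x).2)) hta
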